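/- For integers $s,k\ge 1$ and $i\ge 0$ let $\Gamma_i^{[s,s,s]\times k}$ be the number of $3s\times k$ matrices over $\mathbb F_2$ of rank $i$ of the form $\begin{pmatrix}A\\B\\C\end{pmatrix}$, where $A,B,C$ are persymmetric $s\times k$ matrices (a matrix $[\alpha_{p,q}]$ is persymmetric if $\alpha_{p,q}=\alpha_{r,t}$ whenever $p+q=r+t$). Let $s\ge 1$. (a) For all $k\ge 1$, $\Gamma_i^{[s,s,s]\times k}$ is equal to - $1$ if $i=0$; - $105\cdot 2^{4i-6}-21\cdot 2^{3i-5}$ if $1\le i\le s-1$, $k\ge i+1$; - $7\cdot 2^{k+s-1}-7\cdot 2^{2s}+105\cdot 2^{4s-6}-21\cdot 2^{3s-5}$ if $i=s$, $k\ge s+1$; - $147(5\cdot 2^{j-1}-1)2^{k+s+3j-6}+21\bigl[5\cdot 2^{4s+4j-6}-2^{3s+3j-5}-(155\cdot 2^{j-1}-35)2^{2s+4j-7}\bigr]$ if $i=s+j$, $1\le j\le s-1$, $k\ge s+j+1$; - $7\cdot 2^{2k+2s-2}+21\bigl[35\cdot 2^{k+5s-7}-39\cdot 2^{k+4s-6}\bigr]+7\bigl[15\cdot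 2^{8s-6}-465\cdot 2^{7s-8}+349\cdot 2^{6s-7}\bigr]$ if $i=2s$, $k\ge 2s+1$; - $105\bigl(2^{2k+2s+4j-2}+7\cdot 2^{k+5s+4j-3}-31\cdot 2^{k+4s+5j-3}\bigr)+105\bigl(2^{8s+4j-2}-31\cdot 2^{7s+5j-3}+93\cdot 2^{6s+6j-3}\bigr)$ if $i=2s+1+j$, $0\le j\le s-2$, $k\ge 2s+2+j$; - $2^{3k+3s-3}-7\cdot 2^{2k+6s-6}+7\cdot 2^{k+9s-8}-2^{12s-9}$ if $i=3s$, $k\ge 3s$. (b) In the case $k=i$, $\Gamma_i^{[s,s,s]\times i}$ is equal to - $2^{3s+3i-3}-7\cdot 2^{4i-6}+3\cdot 2^{3i-5}$ if $1\le i\le s+1$; - $2^{6s+3j-3}+7\cdot 2^{2s+5j-8}-7\cdot 2^{2s+4j-7}-7\cdot 2^{4s+4j-6}+3\cdot 2^{3s+3j-5}$ if $i=s+j$, $1\le j\le s+1$; - $2^{9s+3j}-7\cdot 2^{8s+4j-2}+7\cdot 2^{7s+5j-3}-2^{6s+6j-3}$ if $i=2s+1+j$, $0\le j\le s-1$. (c)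 The following reduction formulas hold: - $\Gamma_{2s+1+j}^{[s,s,s]\times k}=16^{3j}\,\Gamma_{2(s-j)+1}^{[s-j,s-j,s-j]\times(k-3j)}$ for $0\le j\le s-2$, $k\ge 2s+2+j$; - $\Gamma_{2s+1+j}^{[s,s,s]\times(2s+1+j)}=16^{3j}\,\Gamma_{2(s-j)+1}^{[s-j,s-j,s-j]\times(2(s-j)+1)}$ for $0\le j\le s-1$; - $\Gamma_{3s}^{[s,s,s]\times k}=16^{3(s-1)}\,\Gamma_3^{[1,1,1]\times(k-3(s-1))}$ for $k\ge 3s$. -/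

import Mathlib

/-- A matrix is persymmetric (Hankel) if the entry in position `(p, q)` depends only on `p + q`. -/
def IsPersymmetric {R : Type*} {m n : ℕ} (A : Matrix (Fin m) (Fin n) R) : Prop :=
  ∀ (p r : Fin m) (q t : Fin n), (p : ℕ) + (q : ℕ) = (r : ℕ) + (t : ℕ) → A p q = A r t

/-- The set of triple persymmetric matrices over `𝔽₂` with `k` columns and blocks of `a`, `b`
and `c` rows: the three persymmetric blocks `A`, `B`, `C` are stacked on top of each other. -/
def triplePersymmetric (a b c k : ℕ) :
    Set (Matrix (Fin a ⊕ (Fin b ⊕ Fin c)) (Fin k) (ZMod 2)) :=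
  {M | ∃ (A : Matrix (Fin a) (Fin k) (ZMod 2)) (B : Matrix (Fin b) (Fin k) (ZMod 2))
      (C : Matrix (Fin c) (Fin k) (ZMod 2)),
      IsPersymmetric A ∧ IsPersymmetric B ∧ IsPersymmetric C ∧
        M = Matrix.fromRows A (Matrix.fromRows B C)}

/-- `tripleGamma a b c k i` is the number of triple persymmetric matrices over `𝔽₂` with `k`
columns, blocks of `a`, `b`, `c` rows, and rank `i`. -/
noncomputable def tripleGamma (a b c k i : ℕ) : ℕ :=
  Set.ncard {M | M ∈ triplePersymmetric a b c k ∧ M.rank = i}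

/-!
A triple persymmetric matrix with blocks of `s` rows and with `k` columns is given by a word of
length `N = s + k - 1` in the alphabet `𝔽₂ ^ 3`. The letters are the coefficients of three
polynomials `Pₐ` (`wordPoly`), and the kernel of the matrix consists of the polynomials `u` of
degree `< k` such that each `u * Pₐ` agrees modulo `X ^ (N + 1)` with a polynomial of degree `< k`.
So the rank is a question about the successive minima of the lattice
`{(u, e) | eₐ ≡ u * Pₐ mod X ^ (N + 1)}` in `𝔽₂[X] ^ 4`. If it has a reduced basis with degrees
`N + 1 - yᵢ`, then the values `yᵢ` sum to `N + 1` and the rank is `∑ min yᵢ s - s`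
(`IsReducedBasis.rank_wordMatrix`).

Reading a word letter by letter turns this into a Markov chain. The basis can be kept such that
exactly one leading vector, the marked one, has a nonzero zeroth coordinate. The eight possible
letters then correspond to the eight subsets of the basis that contain the mark, and the step raises
the smallest value in that subset by one and marks it (`IsReducedBasis.step`,
`IsReducedBasis.exists_next`). The distribution of this chain, with values capped at `s`, is
explicit (`stateSum`): a state with `m` values at least `s` and a tuple `l` of smaller values has a
weight which is, apart from normalising constants and `2`-binomial coefficients, a power of `2`
whose exponent is affine in the sum of `l` minus a length `affLen l` familiar from affine
permutations; and the mark sits on the nonzero value of rank `r` with weight proportional to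
`2 ^ r`. That this solves the recursion is a detailed balance: the flow out of an entry being raised
equals the weight of the raised state (`stateWeight_raise`), and where an entry reaches `s` a
geometric sum over its position accounts for the change of `m` (`stateWeight_boundary`).

For rank `i` below the number of columns at least one value is at least `s`, so `l` has at most
three entries. The sums of `2 ^ (-affLen l)` over tuples with prescribed sum satisfy a first-order
recursion, because moving the first entry to the end and lowering it by one preserves the length
(`posSum_succ`). Evaluating them gives the formulas for `i < k`. The number of matrices of rank
`i = k` is then the total number `8 ^ (s + k - 1)` minus a sum of geometric progressions, and the
reduction formulas are read off from the explicit ones.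
-/

section Lattice

open Polynomial

/-! ### Words, lattices and reduced bases -/

/-- The polynomial `∑ₙ w n a * X ^ (N - n)` attached to coordinate `a` of a word `w`. -/
noncomputable def wordPoly {N : ℕ} (w : Fin N → Fin 3 → ZMod 2) (a : Fin 3) : (ZMod 2)[X] :=
  ∑ n : Fin N, C (w n a) * X ^ (N - (n : ℕ))

/-- Membership in the lattice of `(u, e₁, e₂, e₃)` with `eₐ ≡ u * wordPoly w a` modulo
`X ^ (N + 1)`. -/
def InLattice {N : ℕ} (w : Fin N → Fin 3 → ZMod 2) (x : Fin 4 → (ZMod 2)[X]) : Prop :=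
  ∀ a : Fin 3, X ^ (N + 1) ∣ x a.succ - x 0 * wordPoly w a

/-- `b` is a reduced basis of the lattice of `w`: the degree of `b i` is at most `N + 1 - y i`, the
vectors of coefficients in these nominal degrees (the leading vectors) are linearly independent,
and only the leading vector of the marked element `b j` has a nonzero zeroth coordinate. The
codegrees `y i`, which sum to `N + 1`, are called the values of the basis. -/
structure IsReducedBasis {N : ℕ} (w : Fin N → Fin 3 → ZMod 2) (y : Fin 4 → ℕ) (j : Fin 4)
    (b : Fin 4 → Fin 4 → (ZMod 2)[X]) : Prop where
  mem : ∀ i, InLattice w (b i)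
  sum_eq : ∑ i, y i = N + 1
  coeff_eq_zero : ∀ i a t, N + 1 - y i < t → (b i a).coeff t = 0
  indep : ∀ g : Fin 4 → ZMod 2,
    (∀ a, ∑ i, g i * (b i a).coeff (N + 1 - y i) = 0) → ∀ i, g i = 0
  lead : ∀ i, (b i 0).coeff (N + 1 - y i) = if i = j then 1 else 0
  span : ∀ x, InLattice w x → ∃ p : Fin 4 → (ZMod 2)[X], ∀ a, x a = ∑ i, p i * b i a

theorem IsReducedBasis.le {N : ℕ} {w : Fin N → Fin 3 → ZMod 2} {y : Fin 4 → ℕ} {j : Fin 4}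
    {b : Fin 4 → Fin 4 → (ZMod 2)[X]} (h : IsReducedBasis w y j b) (i : Fin 4) :
    y i ≤ N + 1 := by
  rw [← h.sum_eq]
  exact Finset.single_le_sum (f := y) (fun _ _ => Nat.zero_le _) (Finset.mem_univ i)

theorem wordPoly_snoc {N : ℕ} (w : Fin N → Fin 3 → ZMod 2) (v : Fin 3 → ZMod 2) (a : Fin 3) :
    wordPoly (Fin.snoc (α := fun _ => Fin 3 → ZMod 2) w v) a = X * (wordPoly w a + C (v a)) := by
  unfold wordPoly
  rw [Fin.sum_univ_castSucc]
  simp only [Fin.snoc_castSucc, Fin.snoc_last, Fin.val_castSucc, Fin.val_last, mul_add,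
    Finset.mul_sum]
  congr 1
  · refine Finset.sum_congr rfl fun n _ => ?_
    rw [show N + 1 - (n : ℕ) = (N - n) + 1 by have := n.2; omega]
    ring
  · rw [Nat.add_sub_cancel_left, pow_one, X_mul]

theorem coeff_wordPoly {N : ℕ} (w : Fin N → Fin 3 → ZMod 2) (a : Fin 3) (n : Fin N) :
    (wordPoly w a).coeff (N - n) = w n a := by
  unfold wordPoly
  rw [finsetSum_coeff, Finset.sum_eq_single n]
  · simp
  · intro m _ hm
    rw [coeff_C_mul, coeff_X_pow, if_neg, mul_zero]
    intro h
    apply hm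
    ext
    have := m.2
    have := n.2
    omega
  · simp

/-- The top coefficient of a product, at the sum of the two nominal degrees. -/
theorem coeff_mul_top {R : Type*} [CommRing R] {p b : R[X]} {d T : ℕ}
    (hb : ∀ t, d < t → b.coeff t = 0) (hp : ∀ r, T < r + d → p.coeff r = 0) :
    (p * b).coeff T = if d ≤ T then p.coeff (T - d) * b.coeff d else 0 := by
  rw [coeff_mul]
  split_ifs with h
  · rw [Finset.sum_eq_single (T - d, d)]
    · rintro ⟨r, t⟩ hrt hne
      rw [Finset.HasAntidiagonal.mem_antidiagonal] at hrt
      simp only at hrt ⊢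
      rcases lt_trichotomy t d with h1 | h1 | h1
      · rw [hp r (by omega), zero_mul]
      · exact absurd (by rw [← h1, ← hrt]; simp) hne
      · rw [hb t h1, mul_zero]
    · intro h'
      exact absurd (by simp [h]) h'
  · refine Finset.sum_eq_zero ?_
    rintro ⟨r, t⟩ hrt
    rw [Finset.HasAntidiagonal.mem_antidiagonal] at hrt
    simp only at hrt ⊢
    rw [hp r (by omega), zero_mul]

/-- The predictable degree property of a reduced basis: if a combination has degree `< D`, then so
has each of its terms. -/
theorem IsReducedBasis.coeff_eq_zero_of_comb {N : ℕ} {w : Fin N → Fin 3 → ZMod 2} {y : Fin 4 → ℕ}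
    {j : Fin 4} {b : Fin 4 → Fin 4 → (ZMod 2)[X]} (h : IsReducedBasis w y j b)
    (p : Fin 4 → (ZMod 2)[X]) (D : ℕ)
    (hD : ∀ a t, D ≤ t → (∑ i, p i * b i a).coeff t = 0) (i : Fin 4) (r : ℕ)
    (hr : D ≤ r + (N + 1 - y i)) : (p i).coeff r = 0 := by
  have key : ∀ n, (∀ i r, D + n ≤ r + (N + 1 - y i) → (p i).coeff r = 0) →
      ∀ i r, D ≤ r + (N + 1 - y i) → (p i).coeff r = 0 := by
    intro n
    induction n with
    | zero => exact fun h => h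
    | succ n ih =>
      intro hn
      apply ih
      intro i r hir
      rcases Nat.lt_or_ge (D + n) (r + (N + 1 - y i)) with h1 | h1
      · exact hn i r (by omega)
      have hz := h.indep (fun i => if N + 1 - y i ≤ D + n then
        (p i).coeff (D + n - (N + 1 - y i)) else 0) (by
          intro a
          refine Eq.trans ?_ (hD a (D + n) (by omega))
          rw [finsetSum_coeff]
          refine Finset.sum_congr rfl fun i _ => ?_
          rw [coeff_mul_top (h.coeff_eq_zero i a) (fun r hr => hn i r (by omega))]
          split_ifs <;> simp) i
      rw [if_pos (by omega)] at hz
      rwa [show D + n - (N + 1 - y i) = r by omega] at hz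
  refine key (Finset.univ.sup (fun i => (p i).natDegree) + N + 2) ?_ i r hr
  intro i r hr
  apply coeff_eq_zero_of_natDegree_lt
  have := Finset.le_sup (f := fun i => (p i).natDegree) (Finset.mem_univ i)
  omega

/-- For the empty word, `(1, 0)` and the multiples `X * eₐ` of the other unit vectors form a reduced
basis. -/
theorem isReducedBasis_zero (w : Fin 0 → Fin 3 → ZMod 2) :
    IsReducedBasis w ![1, 0, 0, 0] 0
      (fun i a => if i = a then (if i = 0 then 1 else X) else 0) where
  mem := by
    intro i a
    have : wordPoly w a = 0 := by simp [wordPoly]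
    rw [this, mul_zero, sub_zero]
    by_cases h : i = a.succ
    · subst h; simp
    · simp [h]
  sum_eq := by simp [Fin.sum_univ_four]
  coeff_eq_zero := by
    intro i a t ht
    fin_cases i <;> simp at ht ⊢ <;> split_ifs <;>
      simp [coeff_one, coeff_X] <;> omega
  indep := by
    intro g hg i
    have := hg i
    rw [Finset.sum_eq_single i (fun k _ hk => by simp [hk]) (by simp)] at this
    fin_cases i <;> simpa using this
  lead := by
    intro i
    fin_cases i <;> simp
  span := by
    intro x hx
    have h0 : ∀ a : Fin 3, ∃ q, x a.succ = X * q := by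
      intro a
      have := hx a
      simpa [wordPoly, dvd_iff_exists_eq_mul_right] using this
    choose q hq using h0
    refine ⟨Fin.cons (x 0) q, fun a => ?_⟩
    rw [Finset.sum_eq_single a (fun k _ hk => by simp [hk]) (by simp)]
    refine Fin.cases ?_ (fun a => ?_) a
    · simp
    · simp [hq, mul_comm]

/-! ### The reduction step -/

/-- The isomorphism from the lattice of a word `w` to the lattice of `w` followed by `v`. -/
noncomputable def latticeShift (v : Fin 3 → ZMod 2) (x : Fin 4 → (ZMod 2)[X]) :
    Fin 4 → (ZMod 2)[X] :=
  Fin.cons (x 0) fun a => X * (x a.succ + C (v a) * x 0)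

@[simp] theorem latticeShift_zero (v : Fin 3 → ZMod 2) (x : Fin 4 → (ZMod 2)[X]) :
    latticeShift v x 0 = x 0 := rfl

@[simp] theorem latticeShift_succ (v : Fin 3 → ZMod 2) (x : Fin 4 → (ZMod 2)[X]) (a : Fin 3) :
    latticeShift v x a.succ = X * (x a.succ + C (v a) * x 0) := rfl

theorem latticeShift_sum (v : Fin 3 → ZMod 2) (p : Fin 4 → (ZMod 2)[X])
    (b : Fin 4 → Fin 4 → (ZMod 2)[X]) (a : Fin 4) :
    latticeShift v (fun a => ∑ i, p i * b i a) a = ∑ i, p i * latticeShift v (b i) a := by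
  refine Fin.cases ?_ (fun a => ?_) a
  · simp
  · simp only [latticeShift_succ, Finset.mul_sum, ← Finset.sum_add_distrib]
    refine Finset.sum_congr rfl fun i _ => ?_
    ring

theorem inLattice_latticeShift {N : ℕ} {w : Fin N → Fin 3 → ZMod 2} (v : Fin 3 → ZMod 2)
    {x : Fin 4 → (ZMod 2)[X]} (hx : InLattice w x) :
    InLattice (Fin.snoc (α := fun _ => Fin 3 → ZMod 2) w v) (latticeShift v x) := by
  intro a
  rw [wordPoly_snoc, latticeShift_succ, latticeShift_zero, pow_succ' X (N + 1)]
  have : X * (x a.succ + C (v a) * x 0) - x 0 * (X * (wordPoly w a + C (v a)))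
      = X * (x a.succ - x 0 * wordPoly w a) := by ring
  rw [this]
  exact mul_dvd_mul_left _ (hx a)

theorem InLattice.exists_latticeShift {N : ℕ} {w : Fin N → Fin 3 → ZMod 2} {v : Fin 3 → ZMod 2}
    {x : Fin 4 → (ZMod 2)[X]}
    (hx : InLattice (Fin.snoc (α := fun _ => Fin 3 → ZMod 2) w v) x) :
    ∃ z, InLattice w z ∧ x = latticeShift v z := by
  have h1 : ∀ a : Fin 3, ∃ q, x a.succ = X * q := by
    intro a
    have h := hx a
    rw [wordPoly_snoc] at h
    have h2 : X ∣ x a.succ - x 0 * (X * (wordPoly w a + C (v a))) :=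
      (dvd_pow_self X (by omega)).trans h
    have h3 : X ∣ x 0 * (X * (wordPoly w a + C (v a))) := ⟨x 0 * (wordPoly w a + C (v a)), by ring⟩
    exact (dvd_sub_left h3).1 h2
  choose q hq using h1
  refine ⟨Fin.cons (x 0) fun a => q a - C (v a) * x 0, fun a => ?_, ?_⟩
  · have h := hx a
    rw [wordPoly_snoc, pow_succ' X (N + 1), hq] at h
    have h2 : X * q a - x 0 * (X * (wordPoly w a + C (v a)))
        = X * (q a - C (v a) * x 0 - x 0 * wordPoly w a) := by ring
    rw [h2] at h
    simpa using (mul_dvd_mul_iff_left (X_ne_zero (R := ZMod 2))).1 h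
  · funext a
    refine Fin.cases ?_ (fun a => ?_) a
    · simp
    · simp [hq]

theorem InLattice.sum {N : ℕ} {w : Fin N → Fin 3 → ZMod 2} (p : Fin 4 → (ZMod 2)[X])
    {b : Fin 4 → Fin 4 → (ZMod 2)[X]} (hb : ∀ i, InLattice w (b i)) :
    InLattice w (fun a => ∑ i, p i * b i a) := by
  intro a
  have : (∑ i, p i * b i a.succ) - (∑ i, p i * b i 0) * wordPoly w a
      = ∑ i, p i * (b i a.succ - b i 0 * wordPoly w a) := by
    rw [Finset.sum_mul, ← Finset.sum_sub_distrib]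
    refine Finset.sum_congr rfl fun i _ => ?_
    ring
  rw [this]
  exact Finset.dvd_sum fun i _ => Dvd.dvd.mul_left (hb i a) _

/-- One step of lattice reduction. The letter `v` determines the combination `c` of leading vectors
equal to `(1, v)`; replacing the vector of largest degree that occurs in it by the matching
combination keeps that degree, while all other degrees grow by one. -/
theorem IsReducedBasis.step {N : ℕ} {w : Fin N → Fin 3 → ZMod 2} {y : Fin 4 → ℕ} {j : Fin 4}
    {b : Fin 4 → Fin 4 → (ZMod 2)[X]} (h : IsReducedBasis w y j b) (v : Fin 3 → ZMod 2)
    (c : Fin 4 → ZMod 2) (hc0 : ∑ i, c i * (b i 0).coeff (N + 1 - y i) = 1)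
    (hc : ∀ a : Fin 3, ∑ i, c i * (b i a.succ).coeff (N + 1 - y i) = v a)
    (k : Fin 4) (hk : c k = 1) (hmin : ∀ i, c i ≠ 0 → y k ≤ y i) :
    ∃ b', IsReducedBasis (Fin.snoc (α := fun _ => Fin 3 → ZMod 2) w v)
      (Function.update y k (y k + 1)) k b' := by
  set p : Fin 4 → (ZMod 2)[X] := fun i => C (c i) * X ^ (y i - y k) with hp
  have hle := h.le
  set b' : Fin 4 → Fin 4 → (ZMod 2)[X] := fun i =>
    if i = k then fun a => ∑ t, p t * latticeShift v (b t) a else latticeShift v (b i) with hb'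
  have hb'k : ∀ a, b' k a = ∑ t, p t * latticeShift v (b t) a := fun a => by simp [hb']
  have hb'i : ∀ i, i ≠ k → b' i = latticeShift v (b i) := fun i hi => by simp [hb', hi]
  have hdk : N + 1 + 1 - Function.update y k (y k + 1) k = N + 1 - y k := by simp
  have hdi : ∀ i, i ≠ k → N + 1 + 1 - Function.update y k (y k + 1) i = N + 1 - y i + 1 := by
    intro i hi
    have := hle i
    rw [Function.update_of_ne hi]
    omega
  have hyk := hle k
  -- coefficients of the new vector
  have hco : ∀ (f : Fin 4 → (ZMod 2)[X]) (T : ℕ), N + 1 - y k ≤ T →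
      (∑ t, p t * f t).coeff T = ∑ t, c t * (f t).coeff (T - (y t - y k)) := by
    intro f T hT
    rw [finsetSum_coeff]
    refine Finset.sum_congr rfl fun t _ => ?_
    have := hle t
    rw [hp]
    simp only [mul_assoc, coeff_C_mul, coeff_X_pow_mul']
    rw [if_pos (by omega)]
  have hQ : ∀ (i : Fin 4) (a : Fin 3) (t : ℕ), N + 1 - y i < t →
      (b i a.succ + C (v a) * b i 0).coeff t = 0 := by
    intro i a t ht
    rw [coeff_add, coeff_C_mul, h.coeff_eq_zero i _ t ht, h.coeff_eq_zero i _ t ht]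
    simp
  have hQ' : ∀ (i : Fin 4) (a : Fin 3), (b i a.succ + C (v a) * b i 0).coeff (N + 1 - y i)
      = (b i a.succ).coeff (N + 1 - y i) + v a * (b i 0).coeff (N + 1 - y i) := by
    intro i a
    rw [coeff_add, coeff_C_mul]
  have hlead : ∀ i, i ≠ k → (b' i 0).coeff (N + 1 - y i + 1) = 0 := by
    intro i hi
    rw [hb'i i hi, latticeShift_zero]
    exact h.coeff_eq_zero i 0 _ (by omega)
  have hleadk : (b' k 0).coeff (N + 1 - y k) = 1 := by
    rw [hb'k, hco _ _ le_rfl, ← hc0]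
    refine Finset.sum_congr rfl fun t _ => ?_
    by_cases hct : c t = 0
    · simp [hct]
    have := hmin t hct
    have := hle t
    rw [latticeShift_zero, show N + 1 - y k - (y t - y k) = N + 1 - y t by omega]
  refine ⟨b', ?_, ?_, ?_, ?_, ?_, ?_⟩
  · intro i
    by_cases hi : i = k
    · subst hi
      have := InLattice.sum p (fun t => inLattice_latticeShift v (h.mem t))
      simpa only [hb', if_true] using this
    · rw [hb'i i hi]
      exact inLattice_latticeShift v (h.mem i)
  · rw [Finset.sum_update_of_mem (Finset.mem_univ k), ← h.sum_eq,
      ← Finset.add_sum_erase _ _ (Finset.mem_univ k), Finset.sdiff_singleton_eq_erase]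
    omega
  · intro i a t ht
    by_cases hi : i = k
    · subst hi
      rw [hdk] at ht
      rw [hb'k, hco _ _ ht.le]
      refine Fin.cases ?_ (fun a => ?_) a
      · refine Finset.sum_eq_zero fun r _ => ?_
        by_cases hcr : c r = 0
        · simp [hcr]
        have := hmin r hcr
        have := hle r
        rw [latticeShift_zero, h.coeff_eq_zero r 0 _ (by omega), mul_zero]
      · rcases Nat.lt_or_ge (N + 1 - y i + 1) t with h1 | h1
        · refine Finset.sum_eq_zero fun r _ => ?_
          by_cases hcr : c r = 0
          · simp [hcr]
          have := hmin r hcr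
          have := hle r
          rw [latticeShift_succ,
            show t - (y r - y i) = (t - (y r - y i) - 1) + 1 by omega, coeff_X_mul,
            hQ r a _ (by omega), mul_zero]
        · have hsum : ∑ r, c r * (latticeShift v (b r) a.succ).coeff (t - (y r - y i))
              = ∑ r, (c r * (b r a.succ).coeff (N + 1 - y r)
                + v a * (c r * (b r 0).coeff (N + 1 - y r))) := by
            refine Finset.sum_congr rfl fun r _ => ?_
            by_cases hcr : c r = 0
            · simp [hcr]
            have := hmin r hcr
            have := hle r
            rw [latticeShift_succ, show t - (y r - y i) = (N + 1 - y r) + 1 by omega, coeff_X_mul,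
              hQ']
            ring
          rw [hsum, Finset.sum_add_distrib, ← Finset.mul_sum, hc0, hc, mul_one]
          exact CharTwo.add_self_eq_zero _
    · rw [hdi i hi] at ht
      rw [hb'i i hi]
      refine Fin.cases ?_ (fun a => ?_) a
      · exact h.coeff_eq_zero i 0 _ (by omega)
      · rw [latticeShift_succ, show t = (t - 1) + 1 by omega, coeff_X_mul]
        exact hQ i a _ (by omega)
  · intro g hg
    have hgk : g k = 0 := by
      have := hg 0
      rw [Finset.sum_eq_single k] at this
      · rwa [hdk, hleadk, mul_one] at this
      · intro i _ hi
        rw [hdi i hi, hlead i hi, mul_zero]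
      · simp
    set G := ∑ i, g i * (b i 0).coeff (N + 1 - y i) with hG
    have hga : ∀ a : Fin 3, ∑ i, g i * (b i a.succ).coeff (N + 1 - y i) = G * v a := by
      intro a
      have h1 := hg a.succ
      have h2 : ∑ i, g i * (b' i a.succ).coeff (N + 1 + 1 - Function.update y k (y k + 1) i)
          = ∑ i, (g i * (b i a.succ).coeff (N + 1 - y i)
            + v a * (g i * (b i 0).coeff (N + 1 - y i))) := by
        refine Finset.sum_congr rfl fun i _ => ?_
        by_cases hi : i = k
        · subst hi
          simp [hgk]
        · rw [hdi i hi, hb'i i hi, latticeShift_succ, coeff_X_mul, hQ']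
          ring
      rw [h2, Finset.sum_add_distrib, ← Finset.mul_sum, ← hG] at h1
      rw [CharTwo.add_eq_zero.1 h1, mul_comm]
    have hind := h.indep (fun i => g i - G * c i) (by
      intro a
      have : ∀ a, ∑ i, (g i - G * c i) * (b i a).coeff (N + 1 - y i)
          = ∑ i, g i * (b i a).coeff (N + 1 - y i)
            - G * ∑ i, c i * (b i a).coeff (N + 1 - y i) := by
        intro a
        rw [Finset.mul_sum, ← Finset.sum_sub_distrib]
        refine Finset.sum_congr rfl fun i _ => ?_
        ring
      rw [this]
      refine Fin.cases ?_ (fun a => ?_) a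
      · rw [hc0, ← hG]; ring
      · rw [hc, hga]; ring)
    have hG0 : G = 0 := by
      have := hind k
      rw [hgk, hk] at this
      simpa using this
    intro i
    have := hind i
    simpa [hG0] using this
  · intro i
    by_cases hi : i = k
    · subst hi
      rw [hdk, hleadk, if_pos rfl]
    · rw [hdi i hi, hlead i hi, if_neg hi]
  · intro x hx
    obtain ⟨z, hz, rfl⟩ := hx.exists_latticeShift
    obtain ⟨q, hq⟩ := h.span z hz
    refine ⟨fun i => if i = k then q k else q i - q k * p i, fun a => ?_⟩
    rw [show z = fun a => ∑ i, q i * b i a from funext hq, latticeShift_sum]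
    have hpk : p k = 1 := by simp [hp, hk]
    rw [← Finset.add_sum_erase _ _ (Finset.mem_univ k),
      ← Finset.add_sum_erase _ (fun i => (if i = k then q k else q i - q k * p i) * b' i a)
        (Finset.mem_univ k), if_pos rfl, hb'k,
      ← Finset.add_sum_erase _ (fun t => p t * latticeShift v (b t) a) (Finset.mem_univ k), hpk,
      one_mul, mul_add, add_assoc, Finset.mul_sum, ← Finset.sum_add_distrib]
    congr 1
    refine Finset.sum_congr rfl fun i hi => ?_
    have hi := Finset.ne_of_mem_erase hi
    rw [if_neg hi, hb'i i hi]
    ring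

/-! ### Letters as subsets of the basis, and the rank of the block Hankel matrix -/

/-- The leading vectors span the whole space. -/
theorem IsReducedBasis.exists_comb {N : ℕ} {w : Fin N → Fin 3 → ZMod 2} {y : Fin 4 → ℕ} {j : Fin 4}
    {b : Fin 4 → Fin 4 → (ZMod 2)[X]} (h : IsReducedBasis w y j b) (x : Fin 4 → ZMod 2) :
    ∃ c : Fin 4 → ZMod 2, ∀ a, ∑ i, c i * (b i a).coeff (N + 1 - y i) = x a := by
  have hinj : Function.Injective fun (c : Fin 4 → ZMod 2) (a : Fin 4) =>
      ∑ i, c i * (b i a).coeff (N + 1 - y i) := by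
    intro c c' hcc
    funext i
    have := h.indep (fun i => c i - c' i) (fun a => by
      have := congrFun hcc a
      simp only [sub_mul, Finset.sum_sub_distrib] at this ⊢
      rw [this, sub_self]) i
    exact sub_eq_zero.1 this
  obtain ⟨c, hc⟩ := (Finite.injective_iff_surjective.1 hinj) x
  exact ⟨c, fun a => congrFun hc a⟩

/-- The possible next letters correspond to the subsets `c` of the basis that contain the marked
vector, and the step raises the smallest value of `y` on `c`. -/
theorem IsReducedBasis.exists_next {N : ℕ} {w : Fin N → Fin 3 → ZMod 2} {y : Fin 4 → ℕ} {j : Fin 4}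
    (h : ∃ b, IsReducedBasis w y j b) :
    ∃ (e : (Fin 3 → ZMod 2) ≃ {c : Finset (Fin 4) // j ∈ c}) (k : (Fin 3 → ZMod 2) → Fin 4),
      ∀ v, k v ∈ (e v).1 ∧ (∀ i ∈ (e v).1, y (k v) ≤ y i) ∧
        ∃ b', IsReducedBasis (Fin.snoc (α := fun _ => Fin 3 → ZMod 2) w v)
          (Function.update y (k v) (y (k v) + 1)) (k v) b' := by
  obtain ⟨b, h⟩ := h
  choose c hc using fun v : Fin 3 → ZMod 2 => h.exists_comb (Fin.cons 1 v)
  have hc0 : ∀ v, ∑ i, c v i * (b i 0).coeff (N + 1 - y i) = 1 := fun v => by simp [hc]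
  have hcs : ∀ v (a : Fin 3), ∑ i, c v i * (b i a.succ).coeff (N + 1 - y i) = v a :=
    fun v a => by simp [hc]
  have h2 : ∀ x : ZMod 2, x ≠ 0 → x = 1 := by decide
  have hcj : ∀ v, c v j = 1 := fun v => by
    have := hc0 v
    simpa [h.lead] using this
  let f : (Fin 3 → ZMod 2) → {c : Finset (Fin 4) // j ∈ c} := fun v =>
    ⟨Finset.univ.filter fun i => c v i ≠ 0, by simp [hcj]⟩
  have hf : Function.Bijective f := by
    rw [Fintype.bijective_iff_injective_and_card]
    constructor
    · intro v v' hv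
      have hcc : c v = c v' := by
        funext i
        have h1 : i ∈ (f v).1 ↔ i ∈ (f v').1 := by rw [hv]
        simp only [f, Finset.mem_filter, Finset.mem_univ, true_and] at h1
        by_cases hi : c v i = 0
        · rw [hi, eq_comm]
          by_contra hi'
          exact h1.2 hi' hi
        · rw [h2 _ hi, h2 _ (h1.1 hi)]
      funext a
      rw [← hcs v a, ← hcs v' a, hcc]
    · have h8 : ∀ j : Fin 4, Fintype.card {c : Finset (Fin 4) // j ∈ c} = 8 := by decide
      rw [h8]
      simp [ZMod.card]
  have hk : ∀ v, ∃ k ∈ (f v).1, ∀ i ∈ (f v).1, y k ≤ y i := fun v =>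
    Finset.exists_min_image _ _ ⟨j, (f v).2⟩
  choose k hk1 hk2 using hk
  refine ⟨Equiv.ofBijective f hf, k, fun v => ⟨hk1 v, hk2 v, ?_⟩⟩
  refine h.step v (c v) (hc0 v) (hcs v) (k v) (h2 _ ?_) fun i hi => hk2 v i ?_
  · simpa [f] using hk1 v
  · simpa [f] using hi

/-- The block Hankel matrix with `3` blocks of `s` rows and with `k` columns attached to a word. -/
def wordMatrix (s k : ℕ) (w : Fin (s + k - 1) → Fin 3 → ZMod 2) :
    Matrix (Fin s ⊕ (Fin s ⊕ Fin s)) (Fin k) (ZMod 2) :=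
  Matrix.fromRows (Matrix.of fun p q => w ⟨p + q, by omega⟩ 0)
    (Matrix.fromRows (Matrix.of fun p q => w ⟨p + q, by omega⟩ 1)
      (Matrix.of fun p q => w ⟨p + q, by omega⟩ 2))

theorem wordMatrix_mulVec_eq_zero_iff {s k : ℕ} (w : Fin (s + k - 1) → Fin 3 → ZMod 2)
    (u : Fin k → ZMod 2) :
    (wordMatrix s k w).mulVec u = 0 ↔
      ∀ (a : Fin 3) (p : Fin s), ∑ q : Fin k, w ⟨p + q, by omega⟩ a * u q = 0 := by
  have h : ∀ a : Fin 3, ((Matrix.of fun (p : Fin s) (q : Fin k) =>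
      w ⟨p + q, by omega⟩ a).mulVec u = 0 ↔
      ∀ p : Fin s, ∑ q : Fin k, w ⟨p + q, by omega⟩ a * u q = 0) := by
    intro a
    rw [funext_iff]
    rfl
  have h0 : ∀ (x : Fin s → ZMod 2) (y : Fin s ⊕ Fin s → ZMod 2),
      Sum.elim x y = 0 ↔ x = 0 ∧ y = 0 := by
    intro x y
    simp [funext_iff]
  have h0' : ∀ (x y : Fin s → ZMod 2),
      Sum.elim x y = 0 ↔ x = 0 ∧ y = 0 := by
    intro x y
    simp [funext_iff]
  unfold wordMatrix
  rw [Matrix.fromRows_mulVec, Matrix.fromRows_mulVec, h0, h0', h, h, h]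
  constructor
  · rintro ⟨h1, h2, h3⟩ a
    fin_cases a
    exacts [h1, h2, h3]
  · exact fun h => ⟨h 0, h 1, h 2⟩

/-- For `u` of degree `< k`, the coefficients of `u * wordPoly w a` in degrees `k, …, N` are the
entries of the product of the block Hankel matrix with `u`. -/
theorem coeff_mul_wordPoly {s k : ℕ} (w : Fin (s + k - 1) → Fin 3 → ZMod 2) (a : Fin 3)
    {u : (ZMod 2)[X]} (hu : ∀ t, k ≤ t → u.coeff t = 0) (p : Fin s) :
    (u * wordPoly w a).coeff (s + k - 1 - p)
      = ∑ q : Fin k, w ⟨p + q, by omega⟩ a * u.coeff q := by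
  rw [coeff_mul, Finset.Nat.sum_antidiagonal_eq_sum_range_succ
    (fun r t => u.coeff r * (wordPoly w a).coeff t)]
  have hsum : ∑ q : Fin k, w ⟨p + q, by omega⟩ a * u.coeff q
      = ∑ q ∈ Finset.range k, if h : (p : ℕ) + q < s + k - 1 then
        w ⟨p + q, h⟩ a * u.coeff q else 0 := by
    rw [← Fin.sum_univ_eq_sum_range (fun q => if h : (p : ℕ) + q < s + k - 1 then
      w ⟨p + q, h⟩ a * u.coeff q else 0) k]
    refine Finset.sum_congr rfl fun q _ => ?_
    rw [dif_pos (by omega)]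
  rw [hsum]
  have hp := p.2
  have hsub : Finset.range k ⊆ Finset.range (s + k - 1 - p + 1) := by
    intro q hq
    rw [Finset.mem_range] at hq ⊢
    omega
  rw [← Finset.sum_subset hsub]
  · refine Finset.sum_congr rfl fun q hq => ?_
    rw [Finset.mem_range] at hq
    rw [dif_pos (by omega), mul_comm,
      ← coeff_wordPoly w a ⟨p + q, by omega⟩,
      show s + k - 1 - (p : ℕ) - q = s + k - 1 - (p + q) by omega]
  · intro q _ hq
    rw [hu q (by simpa using hq), zero_mul]

/-- Combinations whose `i`-th coefficient has degree less than `y i - s` have degree less than `k`.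
Their zeroth coordinates are exactly the kernel vectors of the block Hankel matrix. -/
theorem IsReducedBasis.coeff_comb_eq_zero {N : ℕ} {w : Fin N → Fin 3 → ZMod 2} {y : Fin 4 → ℕ}
    {j : Fin 4} {b : Fin 4 → Fin 4 → (ZMod 2)[X]} (h : IsReducedBasis w y j b)
    (p : Fin 4 → (ZMod 2)[X]) {s k : ℕ} (hN : N + 1 = s + k)
    (hp : ∀ i, p i ∈ degreeLT (ZMod 2) (y i - s)) (a : Fin 4) (t : ℕ) (ht : k ≤ t) :
    (∑ i, p i * b i a).coeff t = 0 := by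
  rw [finsetSum_coeff]
  refine Finset.sum_eq_zero fun i _ => ?_
  have hz : ∀ r, y i - s ≤ r → (p i).coeff r = 0 := fun r hr => by
    refine coeff_eq_zero_of_degree_lt ((mem_degreeLT.1 (hp i)).trans_le ?_)
    exact_mod_cast hr
  have := h.le i
  rcases Nat.lt_or_ge s (y i) with h1 | h1
  · rw [coeff_mul_top (h.coeff_eq_zero i a) (fun r hr => hz r (by omega))]
    split_ifs with h2
    · rw [hz _ (by omega), zero_mul]
    · rfl
  · have : p i = 0 := by
      ext r
      rw [hz r (by omega), coeff_zero]
    rw [this, zero_mul, coeff_zero]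

/-- The rank of the block Hankel matrix, read off from the degrees of a reduced basis. -/
theorem IsReducedBasis.rank_wordMatrix {s k : ℕ} (hs : 1 ≤ s) (hk : 1 ≤ k)
    {w : Fin (s + k - 1) → Fin 3 → ZMod 2} {y : Fin 4 → ℕ} {j : Fin 4}
    {b : Fin 4 → Fin 4 → (ZMod 2)[X]} (h : IsReducedBasis w y j b) :
    (wordMatrix s k w).rank + ∑ i, (y i - s) = k := by
  have hN : s + k - 1 + 1 = s + k := by omega
  let f : (Π i : Fin 4, degreeLT (ZMod 2) (y i - s)) →ₗ[ZMod 2]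
      LinearMap.ker (wordMatrix s k w).mulVecLin :=
    { toFun := fun p => ⟨fun q => (∑ i, (p i : (ZMod 2)[X]) * b i 0).coeff q, by
        rw [LinearMap.mem_ker, Matrix.mulVecLin_apply, wordMatrix_mulVec_eq_zero_iff]
        intro a r
        have hz := h.coeff_comb_eq_zero (fun i => (p i : (ZMod 2)[X])) hN (fun i => (p i).2)
        rw [← coeff_mul_wordPoly w a (hz 0) r]
        have hl := InLattice.sum (fun i => (p i : (ZMod 2)[X])) h.mem a
        rw [X_pow_dvd_iff] at hl
        have h1 := hl (s + k - 1 - r) (by omega)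
        rw [coeff_sub, hz a.succ _ (by omega), zero_sub, neg_eq_zero] at h1
        exact h1⟩
      map_add' := fun p p' => by
        ext q
        simp [add_mul, Finset.sum_add_distrib]
      map_smul' := fun r p => by
        ext q
        simp [Finset.mul_sum] }
  have hf : Function.Bijective f := by
    constructor
    · rw [injective_iff_map_eq_zero]
      intro p hp
      have hz := h.coeff_comb_eq_zero (fun i => (p i : (ZMod 2)[X])) hN (fun i => (p i).2)
      have hU : ∑ i, (p i : (ZMod 2)[X]) * b i 0 = 0 := by
        ext q
        rcases Nat.lt_or_ge q k with hq | hq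
        · exact congrFun (congrArg Subtype.val hp) ⟨q, hq⟩
        · exact hz 0 q hq
      have hE : ∀ a, ∑ i, (p i : (ZMod 2)[X]) * b i a = 0 := by
        intro a
        refine Fin.cases hU (fun a => ?_) a
        have hl := InLattice.sum (fun i => (p i : (ZMod 2)[X])) h.mem a
        simp only at hl
        rw [hU, zero_mul, sub_zero, X_pow_dvd_iff] at hl
        ext q
        rcases Nat.lt_or_ge q k with hq | hq
        · exact hl q (by omega)
        · exact hz a.succ q hq
      funext i
      ext r
      refine h.coeff_eq_zero_of_comb (fun i => (p i : (ZMod 2)[X])) 0 (fun a t _ => ?_) i r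
        (Nat.zero_le _)
      rw [hE, coeff_zero]
    · rintro ⟨u, hu⟩
      rw [LinearMap.mem_ker, Matrix.mulVecLin_apply, wordMatrix_mulVec_eq_zero_iff] at hu
      set U : (ZMod 2)[X] := ∑ q : Fin k, C (u q) * X ^ (q : ℕ) with hU
      have hUq : ∀ q : Fin k, U.coeff q = u q := by
        intro q
        rw [hU, finsetSum_coeff, Finset.sum_eq_single q]
        · simp
        · intro r _ hr
          rw [coeff_C_mul, coeff_X_pow, if_neg, mul_zero]
          exact fun h => hr (Fin.ext h.symm)
        · simp
      have hUk : ∀ t, k ≤ t → U.coeff t = 0 := by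
        intro t ht
        rw [hU, finsetSum_coeff]
        refine Finset.sum_eq_zero fun r _ => ?_
        rw [coeff_C_mul, coeff_X_pow, if_neg (by omega), mul_zero]
      let V : Fin 4 → (ZMod 2)[X] := Fin.cons U fun a =>
        ∑ t ∈ Finset.range k, C ((U * wordPoly w a).coeff t) * X ^ t
      have hV : ∀ (a : Fin 3) t, (V a.succ).coeff t
          = if t < k then (U * wordPoly w a).coeff t else 0 := by
        intro a t
        simp only [V, Fin.cons_succ, finsetSum_coeff, coeff_C_mul, coeff_X_pow]
        simp
      have hVl : InLattice w V := by
        intro a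
        rw [X_pow_dvd_iff]
        intro t ht
        rw [coeff_sub, hV]
        split_ifs with h1
        · simp [V]
        · have h2 := coeff_mul_wordPoly w a hUk ⟨s + k - 1 - t, by omega⟩
          simp only [hUq] at h2
          rw [hu a ⟨s + k - 1 - t, by omega⟩,
            show s + k - 1 - (s + k - 1 - t) = t by omega] at h2
          simp [V, h2]
      obtain ⟨p, hp⟩ := h.span V hVl
      have hpc := h.coeff_eq_zero_of_comb p k (fun a t ht => by
        rw [← hp]
        refine Fin.cases ?_ (fun a => ?_) a
        · exact hUk t ht
        · rw [hV, if_neg (by omega)])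
      refine ⟨fun i => ⟨p i, ?_⟩, ?_⟩
      · rw [mem_degreeLT, degree_lt_iff_coeff_zero]
        intro r hr
        have := h.le i
        exact hpc i r (by omega)
      · ext q
        change (∑ i, p i * b i 0).coeff q = u q
        rw [← hp, ← hUq]
        rfl
  have h1 := (LinearEquiv.ofBijective f hf).finrank_eq
  have h2 : ∀ n, Module.finrank (ZMod 2) (degreeLT (ZMod 2) n) = n := fun n => by
    rw [(degreeLTEquiv (ZMod 2) n).finrank_eq, Module.finrank_fin_fun]
  have h3 : ∀ n, Module.Finite (ZMod 2) (degreeLT (ZMod 2) n) := fun n =>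
    Module.Finite.equiv (degreeLTEquiv (ZMod 2) n).symm
  have h4 : ∀ n, Module.Free (ZMod 2) (degreeLT (ZMod 2) n) := fun n => inferInstance
  rw [Module.finrank_pi_fintype] at h1
  simp only [h2] at h1
  have h5 := LinearMap.finrank_range_add_finrank_ker (wordMatrix s k w).mulVecLin
  rw [Module.finrank_fin_fun, ← h1] at h5
  exact h5

end Lattice

section Distribution

open Finset

/-! ### Sums over subsets that depend on the least element -/

/-- The elements of `S`, sorted by an injective key, have the ranks `0, …, |S| - 1`. -/
theorem sum_two_pow_rank {ι α : Type*} [LinearOrder α] [DecidableEq ι] {κ : ι → α}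
    (hκ : Function.Injective κ) (S : Finset ι) :
    ∑ t ∈ S, (2 : ℚ) ^ (S.filter fun u => κ u < κ t).card = 2 ^ S.card - 1 := by
  induction S using Finset.induction_on_max_value κ with
  | empty => simp
  | insert a S ha hmax ih =>
    rw [sum_insert ha, card_insert_of_notMem ha]
    have h1 : (insert a S).filter (fun u => κ u < κ a) = S := by
      ext u
      simp only [mem_filter, mem_insert]
      constructor
      · rintro ⟨rfl | h, h2⟩
        · exact absurd h2 (lt_irrefl _)
        · exact h
      · intro h
        exact ⟨Or.inr h, lt_of_le_of_ne (hmax u h) fun h' => ha (hκ h' ▸ h)⟩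
    have h2 : ∀ t ∈ S, (insert a S).filter (fun u => κ u < κ t) = S.filter fun u => κ u < κ t := by
      intro t ht
      rw [filter_insert, if_neg (not_lt.2 (hmax t ht))]
    rw [h1, sum_congr rfl fun t ht => by rw [h2 t ht], ih]
    ring

/-- Sums over the subsets that contain `j` of a function of their least element. -/
theorem sum_subsets_min {ι α : Type*} [LinearOrder α] [Fintype ι] [DecidableEq ι] {κ : ι → α}
    (hκ : Function.Injective κ) (j : ι) (g : ι → ℚ) (g' : Finset ι → ℚ)
    (hg : ∀ c t, t ∈ c → (∀ u ∈ c, κ t ≤ κ u) → g' c = g t) :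
    ∑ c with j ∈ c, g' c = ∑ t, (if κ t < κ j then 2 ^ (univ.filter fun u => κ t < κ u).card / 2
      else if t = j then 2 ^ (univ.filter fun u => κ t < κ u).card else 0) * g t := by
  have hex : ∀ c : Finset ι, ∃ t, j ∈ c → t ∈ c ∧ ∀ u ∈ c, κ t ≤ κ u := by
    intro c
    by_cases hj : j ∈ c
    · obtain ⟨t, h1, h2⟩ := exists_min_image c κ ⟨j, hj⟩
      exact ⟨t, fun _ => ⟨h1, h2⟩⟩
    · exact ⟨j, fun h => absurd h hj⟩
  choose am ham using hex
  rw [← sum_fiberwise (univ.filter fun c : Finset ι => j ∈ c) am g']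
  refine sum_congr rfl fun t _ => ?_
  have hset : (univ.filter fun c : Finset ι => j ∈ c).filter (fun c => am c = t)
      = Icc ({t, j} : Finset ι) (univ.filter fun u => κ t ≤ κ u) := by
    ext c
    simp only [mem_filter, mem_univ, true_and, mem_Icc, subset_iff, mem_insert,
      mem_singleton, forall_eq_or_imp, forall_eq]
    constructor
    · rintro ⟨h1, rfl⟩
      exact ⟨⟨(ham c h1).1, h1⟩, fun u hu => (ham c h1).2 u hu⟩
    · rintro ⟨⟨h1, h2⟩, h3⟩
      exact ⟨h2, hκ (le_antisymm ((ham c h2).2 t h1) (h3 (ham c h2).1))⟩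
  have hgt : ∀ c ∈ (univ.filter fun c : Finset ι => j ∈ c).filter (fun c => am c = t),
      g' c = g t := by
    intro c hc
    simp only [mem_filter, mem_univ, true_and] at hc
    rw [← hc.2]
    exact hg c _ (ham c hc.1).1 (ham c hc.1).2
  rw [sum_congr rfl hgt, sum_const, hset, nsmul_eq_mul]
  congr 1
  have hge : (univ.filter fun u => κ t ≤ κ u) = insert t (univ.filter fun u => κ t < κ u) := by
    ext u
    simp only [mem_filter, mem_univ, true_and, mem_insert, le_iff_lt_or_eq]
    constructor
    · rintro (h | h)
      exacts [Or.inr h, Or.inl (hκ h).symm]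
    · rintro (h | h)
      exacts [Or.inr (by rw [h]), Or.inl h]
  have hge' : (univ.filter fun u => κ t ≤ κ u).card
      = (univ.filter fun u => κ t < κ u).card + 1 := by
    rw [hge, card_insert_of_notMem (by simp)]
  rcases lt_trichotomy (κ t) (κ j) with h | h | h
  · have hne : t ≠ j := fun h' => by simp [h'] at h
    rw [if_pos h, card_Icc_finset (by
      simp only [insert_subset_iff, singleton_subset_iff, mem_filter, mem_univ, true_and]
      exact ⟨le_rfl, h.le⟩), hge', card_pair hne]
    have h1 : 1 ≤ (univ.filter fun u => κ t < κ u).card :=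
      card_pos.2 ⟨j, by simpa using h⟩
    obtain ⟨n, hn⟩ := Nat.exists_eq_add_of_le h1
    rw [hn, show 1 + n + 1 - 2 = n by omega, pow_add]
    push_cast
    ring
  · have := hκ h
    subst this
    rw [if_neg (lt_irrefl _), if_pos rfl, card_Icc_finset (by simp), hge']
    simp
  · have hne : t ≠ j := fun h' => by simp [h'] at h
    rw [if_neg h.not_gt, if_neg hne]
    rw [Nat.cast_eq_zero, card_eq_zero, Icc_eq_empty]
    intro hle
    have := hle (show j ∈ ({t, j} : Finset ι) by simp)
    simp only [mem_filter, mem_univ, true_and] at this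
    exact absurd h this.not_gt

/-- Averaging over the marked element: if the mark sits on `j` with weight `2 ^ (rank of j)` inside
an upper set `P`, then the least element of a random subset containing the mark is distributed as
the least element of a random nonempty subset. -/
theorem sum_mark_subsets_min {ι α : Type*} [LinearOrder α] [Fintype ι] [DecidableEq ι] {κ : ι → α}
    (hκ : Function.Injective κ) (P : Finset ι) (hP : ∀ i ∈ P, ∀ j, κ i < κ j → j ∈ P)
    (g : ι → ℚ) (g' : ι → Finset ι → ℚ)
    (hg : ∀ j c t, j ∈ c → t ∈ c → (∀ u ∈ c, κ t ≤ κ u) → g' j c = g t) :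
    ∑ j ∈ P, 2 ^ (P.filter fun u => κ u < κ j).card * ∑ c with j ∈ c, g' j c
      = ∑ t, 2 ^ (univ.filter fun u => κ t < κ u).card
        * (if t ∈ P then 2 ^ P.card / 2 else (2 ^ P.card - 1) / 2) * g t := by
  have hg2 : ∀ j, ∑ c with j ∈ c, g' j c = _ := fun j => by
    refine sum_subsets_min hκ j g (fun c => if j ∈ c then g' j c else
      if h : ∃ t ∈ c, ∀ u ∈ c, κ t ≤ κ u then g h.choose else 0) ?_ |>.symm.trans ?_ |>.symm
    · intro c t h1 h2
      split_ifs with h3 h4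
      · exact hg j c t h3 h1 h2
      · congr 1
        exact hκ (le_antisymm (h4.choose_spec.2 t h1) (h2 _ h4.choose_spec.1))
      · exact absurd ⟨t, h1, h2⟩ h4
    · refine sum_congr rfl fun c hc => ?_
      simp only [mem_filter, mem_univ, true_and] at hc
      rw [if_pos hc]
  simp only [hg2, mul_sum]
  rw [sum_comm]
  refine sum_congr rfl fun t _ => ?_
  simp only [← mul_assoc]
  rw [← sum_mul]
  congr 1
  set B : ℚ := 2 ^ (univ.filter fun u => κ t < κ u).card with hB
  by_cases ht : t ∈ P
  · rw [if_pos ht]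
    have hlow : ∑ j ∈ P.filter (fun j => κ j ≤ κ t), (2 : ℚ) ^ (P.filter fun u => κ u < κ j).card
        = 2 * 2 ^ (P.filter fun u => κ u < κ t).card - 1 := by
      have h1 := sum_two_pow_rank hκ (P.filter (fun j => κ j ≤ κ t))
      have h2 : (P.filter (fun j => κ j ≤ κ t)).card = (P.filter fun u => κ u < κ t).card + 1 := by
        rw [← card_insert_of_notMem (s := P.filter fun u => κ u < κ t) (a := t) (by simp)]
        congr 1
        ext u
        simp only [mem_filter, mem_insert, le_iff_lt_or_eq]
        constructor
        · rintro ⟨h, h' | h'⟩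
          exacts [Or.inr ⟨h, h'⟩, Or.inl (hκ h')]
        · rintro (rfl | h)
          exacts [⟨ht, Or.inr rfl⟩, ⟨h.1, Or.inl h.2⟩]
      rw [h2, pow_succ'] at h1
      rw [← h1]
      refine sum_congr rfl fun j hj => ?_
      rw [filter_filter]
      congr 2
      ext u
      simp only [mem_filter] at hj ⊢
      exact ⟨fun h => ⟨h.1, (h.2.trans_le hj.2).le, h.2⟩, fun h => ⟨h.1, h.2.2⟩⟩
    have hall := sum_two_pow_rank hκ P
    rw [← sum_filter_add_sum_filter_not P (fun j => κ j ≤ κ t), hlow] at hall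
    have hsplit : ∑ j ∈ P, (2 : ℚ) ^ (P.filter fun u => κ u < κ j).card *
        (if κ t < κ j then B / 2 else if t = j then B else 0)
        = (∑ j ∈ P with ¬ κ j ≤ κ t, (2 : ℚ) ^ (P.filter fun u => κ u < κ j).card) * (B / 2)
          + 2 ^ (P.filter fun u => κ u < κ t).card * B := by
      rw [sum_mul, sum_filter, ← add_sum_erase _ _ ht, if_neg (lt_irrefl _), if_pos rfl,
        ← add_sum_erase P (fun a => if ¬ κ a ≤ κ t then _ else _) ht,
        if_neg (not_not.2 le_rfl), zero_add, add_comm]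
      congr 1
      refine sum_congr rfl fun j hj => ?_
      have hne := ne_of_mem_erase hj
      by_cases h : κ t < κ j
      · rw [if_pos h, if_pos (not_le.2 h)]
      · rw [if_neg h, if_neg (fun h' => hne h'.symm), if_neg (not_not.2 (not_lt.1 h)), mul_zero]
    rw [hsplit]
    linear_combination (B / 2) * hall
  · rw [if_neg ht]
    rw [← sum_two_pow_rank hκ P]
    have : ∀ j ∈ P, (2 : ℚ) ^ (P.filter fun u => κ u < κ j).card *
        (if κ t < κ j then B / 2 else if t = j then B else 0)
        = 2 ^ (P.filter fun u => κ u < κ j).card * (B / 2) := by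
      intro j hj
      rw [if_pos]
      rcases lt_trichotomy (κ t) (κ j) with h | h | h
      · exact h
      · exact absurd (hκ h ▸ hj) ht
      · exact absurd (hP j hj t h) ht
    rw [sum_congr rfl this, ← sum_mul]
    ring

/-! ### The transfer step, and statistics of tuples -/

/-- The value of `φ` after one occurrence of `u` has been raised by one and marked, where values are
capped at `s`. -/
def capStep (s : ℕ) (φ : Multiset ℕ → ℕ → ℚ) (M : Multiset ℕ) (u : ℕ) : ℚ :=
  φ (min (u + 1) s ::ₘ M.erase u) (min (u + 1) s)

/-- The sum of `φ` over the eight successors of the state with values `M` and marked value `v`: a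
subset containing the mark is chosen, and its least element is raised by one and becomes the mark.
Letters correspond bijectively to such subsets. -/
def transfer (s : ℕ) (φ : Multiset ℕ → ℕ → ℚ) (M : Multiset ℕ) (v : ℕ) : ℚ :=
  ((M.erase v).powerset.map fun c => capStep s φ M (c.fold min v)).sum

theorem fold_min_eq {c : Multiset ℕ} {v x : ℕ} (hx : x = v ∨ x ∈ c) (hv : x ≤ v)
    (hc : ∀ y ∈ c, x ≤ y) : c.fold min v = x := by
  induction c using Multiset.induction_on generalizing x with
  | empty =>
    rcases hx with h | h
    · simp [h]
    · simp at h
  | cons a c ih =>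
    rw [Multiset.fold_cons_left]
    have ha := hc a (Multiset.mem_cons_self _ _)
    have hc' : ∀ y ∈ c, x ≤ y := fun y hy => hc y (Multiset.mem_cons_of_mem hy)
    by_cases h : x = v ∨ x ∈ c
    · rw [ih h hv hc', min_eq_right ha]
    · have hxa : x = a := by
        rcases hx with h' | h'
        · exact absurd (Or.inl h') h
        · rcases Multiset.mem_cons.1 h' with h'' | h''
          · exact h''
          · exact absurd (Or.inr h'') h
      have hle : ∀ c : Multiset ℕ, (∀ y ∈ c, x ≤ y) → x ≤ c.fold min v := by
        intro c
        induction c using Multiset.induction_on with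
        | empty => intro _; simpa using hv
        | cons a c ih =>
          intro h
          rw [Multiset.fold_cons_left]
          exact le_min (h a (Multiset.mem_cons_self _ _))
            (ih fun y hy => h y (Multiset.mem_cons_of_mem hy))
      rw [← hxa, min_eq_left (hle c hc')]

theorem powerset_map_eq {α β : Type*} (f : α → β) (s : Multiset α) :
    (s.map f).powerset = s.powerset.map (Multiset.map f) := by
  induction s using Multiset.induction_on with
  | empty => simp
  | cons a s ih =>
    simp [Multiset.powerset_cons, ih, Multiset.map_map]

theorem transfer_eq_sum {ι : Type*} [Fintype ι] [DecidableEq ι] (s : ℕ)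
    (φ : Multiset ℕ → ℕ → ℚ) (y : ι → ℕ) (j : ι) :
    transfer s φ (univ.val.map y) (y j) = ∑ c : Finset ι with j ∈ c,
      capStep s φ (univ.val.map y) (((c.erase j).val.map y).fold min (y j)) := by
  have h1 : (univ.val.map y).erase (y j) = (univ.erase j).val.map y := by
    rw [Finset.erase_val, Multiset.map_erase_of_mem _ _ (Finset.mem_univ_val j)]
  unfold transfer
  rw [h1, powerset_map_eq, Multiset.map_map]
  have h2 : (univ.erase j).val.powerset = ((univ.erase j).powerset).val.map Finset.val := by
    rw [Finset.powerset]
    simp only [Multiset.map_pmap, Multiset.pmap_eq_map, Multiset.map_id']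
  rw [h2, Multiset.map_map]
  change ∑ c ∈ (univ.erase j).powerset, _ = _
  refine Finset.sum_nbij' (fun c : Finset ι => insert j c) (fun c : Finset ι => c.erase j)
    ?_ ?_ ?_ ?_ ?_
  · intro c _
    simp
  · intro c _
    rw [mem_powerset]
    exact erase_subset_erase _ (subset_univ _)
  · intro c hc
    rw [mem_powerset] at hc
    exact erase_insert fun h => by simpa using hc h
  · intro c hc
    exact insert_erase (by simpa using hc)
  · intro c hc
    rw [mem_powerset] at hc
    rw [erase_insert fun h => by simpa using hc h]
    rfl

/-- The least value on a subset containing `j`, computed by folding `min` from the value of `j`. -/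
theorem fold_min_erase {ι : Type*} [DecidableEq ι] (y : ι → ℕ) {j k : ι} {c : Finset ι}
    (hj : j ∈ c) (hk : k ∈ c) (hmin : ∀ i ∈ c, y k ≤ y i) :
    ((c.erase j).val.map y).fold min (y j) = y k := by
  refine fold_min_eq ?_ (hmin j hj) ?_
  · by_cases h : k = j
    · exact Or.inl (by rw [h])
    · exact Or.inr (Multiset.mem_map_of_mem y (mem_erase.2 ⟨h, hk⟩))
  · intro x hx
    obtain ⟨i, hi, rfl⟩ := Multiset.mem_map.1 hx
    exact hmin i (mem_of_mem_erase hi)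

section Tuples

variable {b : ℕ}

/-- The number of nonzero entries. -/
def nonzeroCount (l : Fin b → ℕ) : ℕ := (univ.filter fun t => l t ≠ 0).card

/-- The number of nonzero entries preceding entry `t` in the order by value, then position. -/
def below (l : Fin b → ℕ) (t : Fin b) : ℕ :=
  (univ.filter fun u => l u ≠ 0 ∧ (l u < l t ∨ l u = l t ∧ u < t)).card

/-- The number of entries following entry `t` in the order by value, then position. -/
def above (l : Fin b → ℕ) (t : Fin b) : ℕ :=
  (univ.filter fun u => l t < l u ∨ l t = l u ∧ t < u).card

/-- The contribution to `affLen` of an entry `x` and a later entry `y`. -/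
def pairLen (x y : ℕ) : ℤ := if y < x then (x : ℤ) - y - 1 else (y : ℤ) - x

/-- The sum over all pairs of entries of their distance, less one if the larger entry comes first.
This is the length of the shortest element in the coset, modulo permutations, of the translation by
`l` in the affine symmetric group. -/
def affLen (l : Fin b → ℕ) : ℤ := ∑ i, ∑ j, if i < j then pairLen (l i) (l j) else 0

/-- The multiset consisting of `m` copies of `s` and the entries of `l`. -/
def shape (s m : ℕ) (l : Fin b → ℕ) : Multiset ℕ := Multiset.replicate m s + univ.val.map l

theorem shape_eq_map (s m : ℕ) (l : Fin b → ℕ) :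
    shape s m l = (univ : Finset (Fin m ⊕ Fin b)).val.map (Sum.elim (fun _ => s) l) := by
  rw [show (univ : Finset (Fin m ⊕ Fin b)) = univ.disjSum univ from rfl, Finset.val_disjSum,
    Multiset.disjSum, Multiset.map_add, Multiset.map_map, Multiset.map_map, shape]
  congr 1
  simp only [Function.comp_def, Sum.elim_inl, Multiset.map_const', Finset.card_val, card_univ,
    Fintype.card_fin]

theorem nonzeroCount_insertNth (t : Fin (b + 1)) (x : ℕ) (l : Fin b → ℕ) :
    nonzeroCount (t.insertNth (α := fun _ => ℕ) x l)
      = (if x ≠ 0 then 1 else 0) + nonzeroCount l := by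
  simp only [nonzeroCount, card_filter, Fin.sum_univ_succAbove _ t, Fin.insertNth_apply_same,
    Fin.insertNth_apply_succAbove]

theorem below_insertNth (t : Fin (b + 1)) (x : ℕ) (l : Fin b → ℕ) :
    below (t.insertNth (α := fun _ => ℕ) x l) t
      = ∑ u, if l u ≠ 0 ∧ (l u < x ∨ l u = x ∧ u.castSucc < t) then 1 else 0 := by
  simp only [below, card_filter, Fin.sum_univ_succAbove _ t, Fin.insertNth_apply_same,
    Fin.insertNth_apply_succAbove, lt_irrefl, and_false, or_self, if_false, zero_add,
    Fin.succAbove_lt_iff_castSucc_lt]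

theorem above_insertNth (t : Fin (b + 1)) (x : ℕ) (l : Fin b → ℕ) :
    above (t.insertNth (α := fun _ => ℕ) x l) t
      = ∑ u, if x < l u ∨ x = l u ∧ ¬ u.castSucc < t then 1 else 0 := by
  simp only [above, card_filter, Fin.sum_univ_succAbove _ t, Fin.insertNth_apply_same,
    Fin.insertNth_apply_succAbove, lt_irrefl, and_false, or_self, if_false, zero_add,
    Fin.lt_succAbove_iff_le_castSucc, not_lt]

theorem affLen_insertNth (t : Fin (b + 1)) (x : ℕ) (l : Fin b → ℕ) :
    affLen (t.insertNth (α := fun _ => ℕ) x l)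
      = affLen l + ∑ u, if u.castSucc < t then pairLen (l u) x else pairLen x (l u) := by
  simp only [affLen, Fin.sum_univ_succAbove _ t, Fin.insertNth_apply_same,
    Fin.insertNth_apply_succAbove, lt_irrefl, if_false, zero_add, Fin.succAbove_lt_succAbove_iff,
    Fin.succAbove_lt_iff_castSucc_lt, Fin.lt_succAbove_iff_le_castSucc, sum_add_distrib]
  rw [add_comm, add_assoc, add_comm, add_assoc, ← sum_add_distrib]
  congr 1
  refine sum_congr rfl fun u _ => ?_
  by_cases h : u.castSucc < t
  · rw [if_pos h, if_pos h, if_neg (not_le.2 h), zero_add]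
  · rw [if_neg h, if_neg h, if_pos (not_lt.1 h), add_zero]

theorem sum_insertNth (t : Fin (b + 1)) (x : ℕ) (l : Fin b → ℕ) :
    ∑ i, t.insertNth (α := fun _ => ℕ) x l i = x + ∑ i, l i := by
  simp only [Fin.sum_univ_succAbove _ t, Fin.insertNth_apply_same, Fin.insertNth_apply_succAbove]

theorem shape_insertNth (s m : ℕ) (t : Fin (b + 1)) (x : ℕ) (l : Fin b → ℕ) :
    shape s m (t.insertNth (α := fun _ => ℕ) x l) = x ::ₘ shape s m l := by
  rw [shape, shape, Fin.univ_succAbove b t, Finset.cons_val, Finset.map_val, Multiset.map_cons,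
    Multiset.map_map, Fin.insertNth_apply_same, Multiset.add_cons]
  congr 3
  funext u
  simp

/-- Raising one entry changes the length by the number of entries passed from below minus the
number of entries still above. -/
theorem affLen_insertNth_succ (t : Fin (b + 1)) (x : ℕ) (l : Fin b → ℕ) :
    affLen (t.insertNth (α := fun _ => ℕ) (x + 1) l) = affLen (t.insertNth (α := fun _ => ℕ) x l)
      + below (t.insertNth (α := fun _ => ℕ) (x + 1) l) t + (b - nonzeroCount l)
      - above (t.insertNth (α := fun _ => ℕ) x l) t := by
  have hb : (b : ℤ) = ∑ _u : Fin b, 1 := by simp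
  have hn : (nonzeroCount l : ℤ) = ∑ u, if l u ≠ 0 then (1 : ℤ) else 0 := by
    rw [nonzeroCount, card_filter]
    push_cast
    rfl
  rw [affLen_insertNth, affLen_insertNth, below_insertNth, above_insertNth, hn]
  nth_rw 1 [hb]
  push_cast
  rw [← sum_sub_distrib, add_assoc, add_assoc, ← sum_add_distrib, ← sum_add_distrib, add_sub_assoc,
    ← sum_sub_distrib]
  congr 1
  refine sum_congr rfl fun u _ => ?_
  unfold pairLen
  push_cast
  split_ifs <;> omega

end Tuples

/-! ### Weights of states -/

/-- All tuples of length `b` with entries `< s`. -/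
def boxTuples (b s : ℕ) : Finset (Fin b → ℕ) := Fintype.piFinset fun _ => range s

theorem mem_boxTuples {b s : ℕ} {l : Fin b → ℕ} : l ∈ boxTuples b s ↔ ∀ t, l t < s := by
  simp [boxTuples]

/-- Summation over tuples with entries in `S`, with entry `t` split off. -/
theorem sum_piFinset_insertNth {b : ℕ} (S : Finset ℕ) (t : Fin (b + 1))
    (f : (Fin (b + 1) → ℕ) → ℚ) :
    ∑ l ∈ Fintype.piFinset (fun _ => S), f l
      = ∑ x ∈ S, ∑ l ∈ Fintype.piFinset (fun _ => S), f (t.insertNth (α := fun _ => ℕ) x l) := by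
  rw [← sum_product']
  refine sum_nbij' (fun l => (l t, t.removeNth l))
    (fun p => t.insertNth (α := fun _ => ℕ) p.1 p.2) ?_ ?_ ?_ ?_ ?_
  · intro l hl
    rw [Fintype.mem_piFinset] at hl
    rw [mem_product, Fintype.mem_piFinset]
    exact ⟨hl t, fun u => hl _⟩
  · rintro ⟨x, l⟩ h
    rw [mem_product, Fintype.mem_piFinset] at h
    rw [Fintype.mem_piFinset, Fin.forall_iff_succAbove t]
    simpa using h
  · intro l _
    exact Fin.insertNth_self_removeNth t l
  · rintro ⟨x, l⟩ _
    simp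
  · intro l _
    exact congrArg f (Fin.insertNth_self_removeNth t l).symm

theorem sum_boxTuples_insertNth {b s : ℕ} (t : Fin (b + 1)) (f : (Fin (b + 1) → ℕ) → ℚ) :
    ∑ l ∈ boxTuples (b + 1) s, f l
      = ∑ x ∈ range s, ∑ l ∈ boxTuples b s, f (t.insertNth (α := fun _ => ℕ) x l) :=
  sum_piFinset_insertNth (range s) t f

/-- The `2`-binomial coefficient `[c + m - 1, m - 1]`: the weight with which the values of `m`
entries, each at least `s`, exceed `m * s` by `c` altogether. For `m = 0` no excess is possible. -/
def stayCoeff : ℕ → ℕ → ℚ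
  | _, 0 => 1
  | 0, _ + 1 => 0
  | m + 1, c + 1 => 2 ^ m * stayCoeff (m + 1) c + stayCoeff m (c + 1)

/-- The weight of the excess over `s` of the `m` large values, after `N` letters and with the small
values summing to `n`; it is zero if there is no room for `m` values at least `s`. -/
def excessWeight (s m N n : ℕ) : ℚ :=
  if m * s + n ≤ N + 1 then stayCoeff m (N + 1 - (m * s + n)) else 0

theorem excessWeight_succ (s m N n : ℕ) :
    excessWeight s (m + 1) (N + 1) n
      = 2 ^ m * excessWeight s (m + 1) N n + excessWeight s m (N + 1) (n + s) := by
  unfold excessWeight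
  rw [show m * s + (n + s) = (m + 1) * s + n by ring]
  rcases lt_trichotomy ((m + 1) * s + n) (N + 1 + 1) with h | h | h
  · rw [if_pos h.le, if_pos (by omega), if_pos h.le,
      show N + 1 + 1 - ((m + 1) * s + n) = (N + 1 - ((m + 1) * s + n)) + 1 by omega, stayCoeff]
  · rw [if_pos h.le, if_neg (by omega), if_pos h.le, h, Nat.sub_self]
    simp [stayCoeff]
  · rw [if_neg (by omega), if_neg (by omega), if_neg (by omega)]
    simp

theorem excessWeight_add_one (s m N n : ℕ) :
    excessWeight s m (N + 1) (n + 1) = excessWeight s m N n := by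
  unfold excessWeight
  rw [show m * s + (n + 1) = m * s + n + 1 by ring]
  simp only [add_le_add_iff_right, Nat.add_sub_add_right]

/-- The `2`-binomial coefficient `[4, m]`. -/
def gaussFour : ℕ → ℚ
  | 0 => 1
  | m + 1 => gaussFour m * (2 ^ (4 - m) - 1) / (2 ^ (m + 1) - 1)

/-- The normalising constant for states with `p` nonzero values. States without nonzero values do
not occur, as the values sum to `N + 1`. -/
def massConst : ℕ → ℚ
  | 0 => 0
  | 1 => 1 / 15
  | p + 2 => massConst (p + 1) * (2 ^ (p + 1) - 1) / 2 ^ (p + 2)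

/-- The weight of the state with `m` values at least `s` and smaller values `l`, after `N` letters,
up to the factor depending on the mark. -/
def stateWeight {b : ℕ} (s N m : ℕ) (l : Fin b → ℕ) : ℚ :=
  massConst (m + nonzeroCount l) * gaussFour m * excessWeight s m N (∑ i, l i)
    * 2 ^ ((m : ℤ) * (m - 1) * s + (3 + m) * (∑ i, l i : ℕ) - affLen l)

theorem massConst_succ {p : ℕ} (hp : p ≠ 0) :
    massConst (p + 1) * 2 ^ (p + 1) = massConst p * (2 ^ p - 1) := by
  obtain ⟨q, rfl⟩ := Nat.exists_eq_succ_of_ne_zero hp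
  rw [Nat.succ_eq_add_one, massConst]
  field_simp

theorem eq_zero_of_nonzeroCount {b : ℕ} {l : Fin b → ℕ} (h : nonzeroCount l = 0) (t : Fin b) :
    l t = 0 := by
  by_contra ht
  exact absurd (card_eq_zero.1 h) (ne_empty_of_mem (a := t) (by simpa using ht))

/-- Detailed balance: the flow out of entry `t` of value `x` is the weight of the state in which
that entry is raised and marked. -/
theorem stateWeight_raise {b : ℕ} (s N m : ℕ) (hmb : m + (b + 1) = 4) (t : Fin (b + 1)) (x : ℕ)
    (l : Fin b → ℕ) :
    stateWeight s N m (t.insertNth (α := fun _ => ℕ) x l)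
      * (2 ^ (m + above (t.insertNth (α := fun _ => ℕ) x l) t)
        * (if x ≠ 0 then 2 ^ (m + nonzeroCount (t.insertNth (α := fun _ => ℕ) x l)) / 2
          else (2 ^ (m + nonzeroCount (t.insertNth (α := fun _ => ℕ) x l)) - 1) / 2))
      = stateWeight s (N + 1) m (t.insertNth (α := fun _ => ℕ) (x + 1) l)
        * 2 ^ below (t.insertNth (α := fun _ => ℕ) (x + 1) l) t := by
  have hlen := affLen_insertNth_succ t x l
  unfold stateWeight
  set A := above (t.insertNth (α := fun _ => ℕ) x l) t
  set B := below (t.insertNth (α := fun _ => ℕ) (x + 1) l) t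
  set ℓ := affLen (t.insertNth (α := fun _ => ℕ) x l)
  rw [hlen, nonzeroCount_insertNth, nonzeroCount_insertNth, sum_insertNth, sum_insertNth,
    if_pos (Nat.succ_ne_zero x), show x + 1 + ∑ i, l i = (x + ∑ i, l i) + 1 by ring,
    excessWeight_add_one]
  set n := x + ∑ i, l i with hn
  set q := nonzeroCount l
  have hm : (m : ℤ) = 3 - b := by omega
  have h2 : (2 : ℚ) ≠ 0 := two_ne_zero
  have e1 : ∀ k : ℕ, (2 : ℚ) ^ k = 2 ^ (k : ℤ) := fun k => (zpow_natCast _ _).symm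
  by_cases hx : x = 0
  · rw [if_neg (not_not.2 hx), if_neg (not_not.2 hx), zero_add]
    by_cases hmq : m + q = 0
    · have hz : excessWeight s m N n = 0 := by
        have hm0 : m = 0 := by omega
        have hl : ∀ i, l i = 0 := eq_zero_of_nonzeroCount (by omega)
        have hn0 : n = 0 := by simp [hn, hx, hl]
        rw [hm0, hn0]
        simp [excessWeight, stayCoeff]
      rw [hz]
      ring
    · have hc := massConst_succ hmq
      rw [show m + (1 + q) = m + q + 1 by ring]
      have hc' : massConst (m + q) * (2 ^ (m + q) - 1) * 2⁻¹
          = massConst (m + q + 1) * 2 ^ ((m : ℤ) + q) := by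
        rw [← hc, pow_succ, e1]
        push_cast
        ring
      have hexp : (2 : ℚ) ^ ((m : ℤ) * (m - 1) * s + (3 + m) * n - ℓ) * 2 ^ (m + A)
          * 2 ^ ((m : ℤ) + q) = 2 ^ ((m : ℤ) * (m - 1) * s + (3 + m) * ((n + 1 : ℕ) : ℤ)
            - (ℓ + B + (b - q) - A)) * 2 ^ B := by
        rw [e1, e1, ← zpow_add₀ h2, ← zpow_add₀ h2, ← zpow_add₀ h2]
        congr 1
        push_cast
        linear_combination hm
      linear_combination (gaussFour m * excessWeight s m N n *
        (2 : ℚ) ^ ((m : ℤ) * (m - 1) * s + (3 + m) * n - ℓ) * 2 ^ (m + A)) * hc'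
        + massConst (m + q + 1) * gaussFour m * excessWeight s m N n * hexp
  · rw [if_pos hx, if_pos hx]
    have hexp : (2 : ℚ) ^ ((m : ℤ) * (m - 1) * s + (3 + m) * n - ℓ) * (2 ^ (m + A)
        * (2 ^ (m + (1 + q)) / 2)) = 2 ^ ((m : ℤ) * (m - 1) * s + (3 + m) * ((n + 1 : ℕ) : ℤ)
            - (ℓ + B + (b - q) - A)) * 2 ^ B := by
      have hhalf : (2 : ℚ) ^ (m + (1 + q)) / 2 = 2 ^ (m + q) := by
        rw [← add_assoc, add_right_comm, pow_succ]
        ring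
      rw [hhalf, e1, e1, e1, ← zpow_add₀ h2, ← zpow_add₀ h2, ← zpow_add₀ h2]
      congr 1
      push_cast
      linear_combination hm
    linear_combination massConst (m + (1 + q)) * gaussFour m * excessWeight s m N n * hexp

theorem gaussFour_succ {m : ℕ} :
    gaussFour (m + 1) * (2 ^ (m + 1) - 1) = gaussFour m * (2 ^ (4 - m) - 1) := by
  have : (2 : ℚ) ^ (m + 1) - 1 ≠ 0 := by
    have : (1 : ℚ) < 2 ^ (m + 1) := one_lt_pow₀ (by norm_num) (by omega)
    linarith
  rw [gaussFour]
  field_simp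

/-- The states in which an entry has just reached `s` and the states in which a value at least `s`
is raised again make up the states with mark at least `s`. -/
theorem stateWeight_boundary {b : ℕ} (s N m : ℕ) (hmb : m + (b + 1) = 4) (l : Fin b → ℕ)
    (hl : l ∈ boxTuples b s) (hs : 1 ≤ s) :
    ∑ t : Fin (b + 1), stateWeight s (N + 1) m (t.insertNth (α := fun _ => ℕ) s l)
        * 2 ^ below (t.insertNth (α := fun _ => ℕ) s l) t
      + stateWeight s N (m + 1) l * ((2 ^ (m + 1) - 1) * (2 ^ (m + 1 + nonzeroCount l) / 2))
      = stateWeight s (N + 1) (m + 1) l * ((2 ^ (m + 1) - 1) * 2 ^ nonzeroCount l) := by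
  rw [mem_boxTuples] at hl
  have h2 : (2 : ℚ) ≠ 0 := two_ne_zero
  have e1 : ∀ k : ℕ, (2 : ℚ) ^ k = 2 ^ (k : ℤ) := fun k => (zpow_natCast _ _).symm
  have hbelow : ∀ t : Fin (b + 1), below (t.insertNth (α := fun _ => ℕ) s l) t
      = nonzeroCount l := by
    intro t
    rw [below_insertNth, nonzeroCount, card_filter]
    refine sum_congr rfl fun u _ => ?_
    have := hl u
    simp [this]
  have hlen : ∀ t : Fin (b + 1), affLen (t.insertNth (α := fun _ => ℕ) s l)
      = affLen l + b * s - (∑ i, l i : ℕ) - (b - t) := by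
    intro t
    have hcnt : ((b : ℤ) - t) = ∑ u : Fin b, if u.castSucc < t then (0 : ℤ) else 1 := by
      have h1 : (∑ u : Fin b, if u.castSucc < t then (0 : ℤ) else 1)
          = ∑ u ∈ range b, if u < (t : ℕ) then (0 : ℤ) else 1 := by
        rw [← Fin.sum_univ_eq_sum_range (fun u => if u < (t : ℕ) then (0 : ℤ) else 1)]
        rfl
      have h3 := sum_range_add_sum_Ico (fun u => if u < (t : ℕ) then (0 : ℤ) else 1)
        (Nat.lt_succ_iff.1 t.2)
      rw [h1, ← h3, sum_eq_zero, zero_add, sum_congr rfl (g := fun _ => 1)]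
      · have := t.2
        simp
        omega
      · intro u hu
        rw [if_neg (by simpa using (mem_Ico.1 hu).1)]
      · intro u hu
        rw [if_pos (by simpa using hu)]
    have hbs : (b : ℤ) * s = ∑ _u : Fin b, (s : ℤ) := by simp
    rw [affLen_insertNth, hcnt, hbs]
    push_cast
    rw [add_sub_assoc, add_sub_assoc, ← sum_sub_distrib, ← sum_sub_distrib]
    congr 1
    refine sum_congr rfl fun u _ => ?_
    have := hl u
    unfold pairLen
    split_ifs <;> omega
  set q := nonzeroCount l with hq
  set n := ∑ i, l i with hn
  have hgeo : ∑ t : Fin (b + 1), (2 : ℚ) ^ (b - (t : ℕ)) = 2 ^ (b + 1) - 1 := by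
    have h3 := sum_range_reflect (fun t => (2 : ℚ) ^ t) (b + 1)
    rw [geom_sum_eq (by norm_num)] at h3
    rw [Fin.sum_univ_eq_sum_range (fun t => (2 : ℚ) ^ (b - t)) (b + 1)]
    norm_num at h3 ⊢
    exact h3
  have hg := gaussFour_succ (m := m)
  rw [show 4 - m = b + 1 by omega] at hg
  have hterm : ∀ t : Fin (b + 1), stateWeight s (N + 1) m (t.insertNth (α := fun _ => ℕ) s l)
        * 2 ^ below (t.insertNth (α := fun _ => ℕ) s l) t
      = massConst (m + 1 + q) * gaussFour m * excessWeight s m (N + 1) (n + s)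
        * (2 ^ (((m + 1 : ℕ) : ℤ) * (((m + 1 : ℕ) : ℤ) - 1) * s
          + (3 + ((m + 1 : ℕ) : ℤ)) * n - affLen l)) * 2 ^ q * 2 ^ (b - (t : ℕ)) := by
    intro t
    have ht := t.2
    unfold stateWeight
    rw [hbelow, hlen, nonzeroCount_insertNth, if_pos (by omega), sum_insertNth, ← hn, ← hq,
      add_comm s n, show m + (1 + q) = m + 1 + q by ring]
    have hm : (m : ℤ) = 3 - b := by omega
    have hexp : (2 : ℚ) ^ ((m : ℤ) * (m - 1) * s + (3 + m) * ((n + s : ℕ) : ℤ)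
        - (affLen l + b * s - n - (b - t)))
        = 2 ^ (((m + 1 : ℕ) : ℤ) * (((m + 1 : ℕ) : ℤ) - 1) * s
          + (3 + ((m + 1 : ℕ) : ℤ)) * n - affLen l) * 2 ^ (b - (t : ℕ)) := by
      rw [e1, ← zpow_add₀ h2]
      congr 1
      rw [Nat.cast_sub (by omega)]
      push_cast
      linear_combination (-s : ℤ) * hm
    rw [hexp]
    ring
  rw [sum_congr rfl fun t _ => hterm t, ← mul_sum, hgeo]
  unfold stateWeight
  rw [← hn, ← hq, excessWeight_succ]
  have hp : (2 : ℚ) ^ (m + 1 + q) / 2 = 2 ^ m * 2 ^ q := by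
    rw [add_right_comm, pow_succ, pow_add]
    ring
  rw [hp]
  linear_combination (-massConst (m + 1 + q) * excessWeight s m (N + 1) (n + s)
    * (2 ^ (((m + 1 : ℕ) : ℤ) * (((m + 1 : ℕ) : ℤ) - 1) * s
          + (3 + ((m + 1 : ℕ) : ℤ)) * n - affLen l)) * 2 ^ q) * hg

/-! ### The explicit distribution of states -/

section Marked

variable {b : ℕ}

/-- The sum of `f` over the possible marked values of the state with `m` values at least `s` and
smaller values `l`. Sorted by value and then by position, the nonzero entry of rank `r` carries the
mark with weight `2 ^ r`; the large values come last, and together have the weight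
`(2 ^ m - 1) * 2 ^ nonzeroCount l`. -/
def markSum (s m : ℕ) (l : Fin b → ℕ) (f : ℕ → ℚ) : ℚ :=
  (2 ^ m - 1) * 2 ^ nonzeroCount l * f s
    + ∑ t, if l t ≠ 0 then 2 ^ below l t * f (l t) else 0

/-- The total order on the `m` large values and the entries of `l`: by value, then by position. -/
def stateKey (s m : ℕ) (l : Fin b → ℕ) (i : Fin m ⊕ Fin b) : ℕ ×ₗ ℕ :=
  toLex (Sum.elim (fun _ => s) l i,
    Sum.elim (fun a : Fin m => (a : ℕ)) (fun a : Fin b => (a : ℕ)) i)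

theorem stateKey_lt {s m : ℕ} {l : Fin b → ℕ} {i j : Fin m ⊕ Fin b} :
    stateKey s m l i < stateKey s m l j ↔
      Sum.elim (fun _ => s) l i < Sum.elim (fun _ => s) l j ∨
      Sum.elim (fun _ => s) l i = Sum.elim (fun _ => s) l j ∧
        Sum.elim (fun a : Fin m => (a : ℕ)) (fun a : Fin b => (a : ℕ)) i
          < Sum.elim (fun a : Fin m => (a : ℕ)) (fun a : Fin b => (a : ℕ)) j := by
  rw [stateKey, stateKey, Prod.Lex.toLex_lt_toLex]

theorem stateKey_injective {s m : ℕ} {l : Fin b → ℕ} (hl : ∀ t, l t < s) :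
    Function.Injective (stateKey s m l) := by
  intro i j h
  have h' := Prod.ext_iff.1 (toLex.injective h)
  rcases i with i | i <;> rcases j with j | j <;>
    simp only [Sum.elim_inl, Sum.elim_inr] at h'
  · rw [Fin.ext h'.2]
  · exact absurd h'.1 (hl j).ne'
  · exact absurd h'.1 (hl i).ne
  · rw [Fin.ext h'.2]

/-- The weights in `markSum` are the powers `2 ^ r` for the ranks `r` with respect to `stateKey`. -/
theorem markSum_eq {s m : ℕ} {l : Fin b → ℕ} (hl : ∀ t, l t < s) (hs : s ≠ 0) (f : ℕ → ℚ)
    {P : Finset (Fin m ⊕ Fin b)} (hP : P = univ.filter fun i => Sum.elim (fun _ => s) l i ≠ 0) :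
    markSum s m l f = ∑ j ∈ P, 2 ^ (P.filter fun u => stateKey s m l u < stateKey s m l j).card
      * f (Sum.elim (fun _ => s) l j) := by
  subst hP
  have hinl : ∀ i : Fin m, ((univ.filter fun i => Sum.elim (fun _ : Fin m => s) l i ≠ 0).filter
      fun u => stateKey s m l u < stateKey s m l (Sum.inl i)).card = nonzeroCount l + i := by
    intro i
    rw [filter_filter, card_filter, Fintype.sum_sum_type, nonzeroCount, card_filter, add_comm]
    congr 1
    · refine sum_congr rfl fun u _ => ?_
      simp [stateKey_lt, hl u]
    · simp only [Sum.elim_inl, stateKey_lt, lt_irrefl, true_and, false_or, ne_eq, hs,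
        not_false_eq_true, ← card_filter]
      rw [show (univ.filter fun u : Fin m => (u : ℕ) < i) = Iio i by ext; simp, Fin.card_Iio]
  have hinr : ∀ t : Fin b, ((univ.filter fun i => Sum.elim (fun _ : Fin m => s) l i ≠ 0).filter
      fun u => stateKey s m l u < stateKey s m l (Sum.inr t)).card = below l t := by
    intro t
    rw [filter_filter, card_filter, Fintype.sum_sum_type, below, card_filter]
    have h0 : ∀ u : Fin m, ¬ stateKey s m l (Sum.inl u) < stateKey s m l (Sum.inr t) := by
      intro u
      simp [stateKey_lt, (hl t).le, (hl t).ne']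
    simp only [h0, and_false, if_false, sum_const_zero, zero_add, stateKey_lt, Sum.elim_inr,
      Fin.val_fin_lt]
  rw [sum_filter, Fintype.sum_sum_type]
  simp only [hinl, hinr, Sum.elim_inl, Sum.elim_inr, ne_eq, hs, not_false_eq_true, if_true]
  rw [markSum, ← sum_mul]
  congr 2
  simp only [pow_add, ← mul_sum]
  rw [Fin.sum_univ_eq_sum_range (fun i => (2 : ℚ) ^ i) m, geom_sum_eq (by norm_num)]
  ring

/-- The transfer step, summed over the mark of a state with values `l` below `s`: every entry can be
raised, and a large value stays large. -/
theorem markSum_transfer {s m : ℕ} {l : Fin b → ℕ} (hl : ∀ t, l t < s) (hs : s ≠ 0)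
    (φ : Multiset ℕ → ℕ → ℚ) :
    markSum s m l (transfer s φ (shape s m l))
      = (2 ^ m - 1) * (2 ^ (m + nonzeroCount l) / 2) * φ (shape s m l) s
        + ∑ t, 2 ^ (m + above l t) * (if l t ≠ 0 then 2 ^ (m + nonzeroCount l) / 2
            else (2 ^ (m + nonzeroCount l) - 1) / 2)
          * φ ((l t + 1) ::ₘ (shape s m l).erase (l t)) (l t + 1) := by
  set P : Finset (Fin m ⊕ Fin b) := univ.filter fun i => Sum.elim (fun _ => s) l i ≠ 0 with hP
  have hPcard : P.card = m + nonzeroCount l := by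
    rw [hP, card_filter, Fintype.sum_sum_type, nonzeroCount, card_filter]
    congr 1
    simp [hs]
  have hval : ∀ i j, stateKey s m l i ≤ stateKey s m l j →
      Sum.elim (fun _ => s) l i ≤ Sum.elim (fun _ => s) l j := by
    intro i j h
    rcases h.lt_or_eq with h | h
    · rcases stateKey_lt.1 h with h | h
      exacts [h.le, h.1.le]
    · rw [stateKey_injective hl h]
  rw [markSum_eq hl hs _ hP]
  have h1 := sum_mark_subsets_min (stateKey_injective (m := m) hl) P (by
      intro i hi j hij
      simp only [hP, mem_filter, mem_univ, true_and] at hi ⊢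
      have := hval i j hij.le
      omega)
    (fun t => capStep s φ (shape s m l) (Sum.elim (fun _ => s) l t))
    (fun j c => capStep s φ (shape s m l)
      (((c.erase j).val.map (Sum.elim (fun _ => s) l)).fold min (Sum.elim (fun _ => s) l j)))
    (by
      intro j c t hj ht hmin
      rw [fold_min_erase _ hj ht fun u hu => hval _ _ (hmin u hu)])
  simp only [shape_eq_map, transfer_eq_sum] at h1 ⊢
  rw [h1, Fintype.sum_sum_type, hPcard]
  have hgt : ∀ i : Fin m, (univ.filter fun u => stateKey s m l (Sum.inl i) < stateKey s m l u).card
      = m - 1 - i := by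
    intro i
    rw [card_filter, Fintype.sum_sum_type]
    have h0 : ∀ u : Fin b, ¬ stateKey s m l (Sum.inl i) < stateKey s m l (Sum.inr u) := by
      intro u
      simp [stateKey_lt, (hl u).le, (hl u).ne']
    simp only [h0, if_false, sum_const_zero, add_zero]
    simp only [Sum.elim_inl, stateKey_lt, lt_irrefl, true_and, false_or, ← card_filter]
    rw [show (univ.filter fun u : Fin m => (i : ℕ) < u) = Ioi i by ext; simp, Fin.card_Ioi]
  have hgt' : ∀ t : Fin b, (univ.filter fun u => stateKey s m l (Sum.inr t) < stateKey s m l u).card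
      = m + above l t := by
    intro t
    rw [card_filter, Fintype.sum_sum_type, above, card_filter]
    congr 1
    · have h0 : ∀ u : Fin m, stateKey s m l (Sum.inr t) < stateKey s m l (Sum.inl u) := by
        intro u
        simp [stateKey_lt, hl t]
      simp [h0]
    · simp only [stateKey_lt, Sum.elim_inr, Fin.val_fin_lt]
  have hmem : ∀ i : Fin m, Sum.inl i ∈ P := by
    intro i
    simp [hP, hs]
  have hmem' : ∀ t : Fin b, Sum.inr t ∈ P ↔ l t ≠ 0 := by
    intro t
    simp [hP]
  simp only [hgt, hgt', hmem, hmem', if_true, Sum.elim_inl, Sum.elim_inr]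
  congr 1
  · rw [← sum_mul, ← sum_mul, Fin.sum_univ_eq_sum_range (fun i => (2 : ℚ) ^ (m - 1 - i)) m,
      sum_range_reflect (fun i => (2 : ℚ) ^ i) m, geom_sum_eq (by norm_num)]
    rcases Nat.eq_zero_or_pos m with rfl | hm
    · simp
    · have hsm : s ∈ Multiset.map (Sum.elim (fun _ : Fin m => s) l) univ.val := by
        rw [Multiset.mem_map]
        exact ⟨Sum.inl ⟨0, hm⟩, mem_univ_val _, rfl⟩
      rw [capStep, min_eq_right (Nat.le_succ s), Multiset.cons_erase hsm]
      ring
  · refine sum_congr rfl fun t _ => ?_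
    rw [capStep, min_eq_left (hl t)]

end Marked

/-- The sum of `φ` over the explicit distribution of states after `N` letters: `m` values are at
least `s`, and the other `4 - m` values form a tuple with entries below `s`. -/
def stateSum (s N : ℕ) (φ : Multiset ℕ → ℕ → ℚ) : ℚ :=
  ∑ p ∈ antidiagonal 4, ∑ l ∈ boxTuples p.2 s,
    stateWeight s N p.1 l * markSum s p.1 l (φ (shape s p.1 l))

/-- Raising entry `t` of all tuples gives the tuples in which that entry is nonzero, and those in
which it has just reached `s`. -/
theorem sum_raise {b s : ℕ} (hs : 1 ≤ s) (t : Fin (b + 1)) (f : (Fin (b + 1) → ℕ) → ℚ) :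
    ∑ x ∈ range s, ∑ l ∈ boxTuples b s, f (t.insertNth (α := fun _ => ℕ) (x + 1) l)
      = ∑ l ∈ boxTuples (b + 1) s, (if l t ≠ 0 then f l else 0)
        + ∑ l ∈ boxTuples b s, f (t.insertNth (α := fun _ => ℕ) s l) := by
  rw [sum_boxTuples_insertNth t]
  simp only [Fin.insertNth_apply_same]
  have h1 := sum_range_succ' (fun x => ∑ l ∈ boxTuples b s,
    f (t.insertNth (α := fun _ => ℕ) x l)) s
  rw [sum_range_succ] at h1
  obtain ⟨r, rfl⟩ := Nat.exists_eq_add_of_le' hs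
  rw [sum_range_succ' (fun x => ∑ l ∈ boxTuples b (r + 1),
    if x ≠ 0 then f (t.insertNth (α := fun _ => ℕ) x l) else 0)]
  simp only [ne_eq, Nat.succ_ne_zero, not_false_eq_true, if_true, not_true_eq_false, if_false,
    sum_const_zero, add_zero]
  rw [sum_range_succ (fun x => ∑ l ∈ boxTuples b (r + 1),
    f (t.insertNth (α := fun _ => ℕ) (x + 1) l))]

/-- The contribution of the states with `m` large values after the transfer step: a large value is
raised, a small value is raised and stays below `s`, or a small value reaches `s`. -/
theorem sum_stateWeight_transfer {b : ℕ} (s N m : ℕ) (hmb : m + (b + 1) = 4) (hs : 1 ≤ s)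
    (φ : Multiset ℕ → ℕ → ℚ) :
    ∑ l ∈ boxTuples (b + 1) s,
        stateWeight s N m l * markSum s m l (transfer s φ (shape s m l))
      = ∑ l ∈ boxTuples (b + 1) s, stateWeight s N m l
          * ((2 ^ m - 1) * (2 ^ (m + nonzeroCount l) / 2)) * φ (shape s m l) s
        + (∑ l ∈ boxTuples (b + 1) s, stateWeight s (N + 1) m l *
            ∑ t, if l t ≠ 0 then 2 ^ below l t * φ (shape s m l) (l t) else 0)
        + ∑ l ∈ boxTuples b s, (∑ t : Fin (b + 1),
            stateWeight s (N + 1) m (t.insertNth (α := fun _ => ℕ) s l)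
              * 2 ^ below (t.insertNth (α := fun _ => ℕ) s l) t) * φ (shape s (m + 1) l) s := by
  have h1 : ∀ l ∈ boxTuples (b + 1) s,
      stateWeight s N m l * markSum s m l (transfer s φ (shape s m l))
      = stateWeight s N m l * ((2 ^ m - 1) * (2 ^ (m + nonzeroCount l) / 2)) * φ (shape s m l) s
        + ∑ t, stateWeight s N m l * (2 ^ (m + above l t) *
            (if l t ≠ 0 then 2 ^ (m + nonzeroCount l) / 2
            else (2 ^ (m + nonzeroCount l) - 1) / 2))
          * φ ((l t + 1) ::ₘ (shape s m l).erase (l t)) (l t + 1) := by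
    intro l hl
    rw [markSum_transfer (mem_boxTuples.1 hl) (by omega), mul_add, mul_sum]
    congr 1
    · ring
    · refine sum_congr rfl fun t _ => ?_
      ring
  rw [sum_congr rfl h1, sum_add_distrib, add_assoc]
  congr 1
  rw [sum_comm]
  simp only [mul_sum, sum_mul]
  rw [sum_comm (s := boxTuples (b + 1) s), sum_comm (s := boxTuples b s), ← sum_add_distrib]
  refine sum_congr rfl fun t _ => ?_
  have h2 := sum_raise hs t (fun l => stateWeight s (N + 1) m l * (2 ^ below l t
    * φ (shape s m l) (l t)))
  simp only [Fin.insertNth_apply_same] at h2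
  rw [sum_boxTuples_insertNth t]
  have h3 : ∀ x ∈ range s, ∀ l ∈ boxTuples b s,
      stateWeight s N m (t.insertNth (α := fun _ => ℕ) x l)
        * (2 ^ (m + above (t.insertNth (α := fun _ => ℕ) x l) t) *
            (if t.insertNth (α := fun _ => ℕ) x l t ≠ 0 then
              2 ^ (m + nonzeroCount (t.insertNth (α := fun _ => ℕ) x l)) / 2
            else (2 ^ (m + nonzeroCount (t.insertNth (α := fun _ => ℕ) x l)) - 1) / 2))
        * φ ((t.insertNth (α := fun _ => ℕ) x l t + 1) ::ₘ
            (shape s m (t.insertNth (α := fun _ => ℕ) x l)).erase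
              (t.insertNth (α := fun _ => ℕ) x l t)) (t.insertNth (α := fun _ => ℕ) x l t + 1)
      = stateWeight s (N + 1) m (t.insertNth (α := fun _ => ℕ) (x + 1) l)
        * (2 ^ below (t.insertNth (α := fun _ => ℕ) (x + 1) l) t
          * φ (shape s m (t.insertNth (α := fun _ => ℕ) (x + 1) l)) (x + 1)) := by
    intro x _ l _
    rw [Fin.insertNth_apply_same, stateWeight_raise s N m hmb t x l, shape_insertNth,
      shape_insertNth, Multiset.erase_cons_head]
    ring
  rw [sum_congr rfl fun x hx => sum_congr rfl fun l hl => h3 x hx l hl, h2]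
  congr 1
  · refine sum_congr rfl fun l _ => ?_
    rw [mul_ite, mul_zero]
  · refine sum_congr rfl fun l _ => ?_
    rw [shape_insertNth, shape, shape, Multiset.replicate_succ, Multiset.cons_add]
    ring

/-- The contribution of the states with `m` large values, split into large and small marks. -/
theorem markSum_shape_split {b : ℕ} (s N m : ℕ) (φ : Multiset ℕ → ℕ → ℚ) :
    ∑ l ∈ boxTuples b s, stateWeight s N m l * markSum s m l (φ (shape s m l))
      = ∑ l ∈ boxTuples b s, stateWeight s N m l
          * ((2 ^ m - 1) * 2 ^ nonzeroCount l) * φ (shape s m l) s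
        + ∑ l ∈ boxTuples b s, stateWeight s N m l *
            ∑ t, if l t ≠ 0 then 2 ^ below l t * φ (shape s m l) (l t) else 0 := by
  rw [← sum_add_distrib]
  refine sum_congr rfl fun l _ => ?_
  rw [markSum]
  ring

/-- The explicit distribution satisfies the recursion of the transfer step. -/
theorem stateSum_transfer (s N : ℕ) (hs : 1 ≤ s) (φ : Multiset ℕ → ℕ → ℚ) :
    stateSum s N (transfer s φ) = stateSum s (N + 1) φ := by
  -- the marks at least `s`: one part stays there, the other part arrives from an entry `s - 1`
  have hbd : ∀ m b, m + (b + 1) = 4 →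
      ∑ l ∈ boxTuples b s, (∑ t : Fin (b + 1),
            stateWeight s (N + 1) m (t.insertNth (α := fun _ => ℕ) s l)
              * 2 ^ below (t.insertNth (α := fun _ => ℕ) s l) t) * φ (shape s (m + 1) l) s
        + ∑ l ∈ boxTuples b s, stateWeight s N (m + 1) l
          * ((2 ^ (m + 1) - 1) * (2 ^ (m + 1 + nonzeroCount l) / 2)) * φ (shape s (m + 1) l) s
      = ∑ l ∈ boxTuples b s, stateWeight s (N + 1) (m + 1) l
          * ((2 ^ (m + 1) - 1) * 2 ^ nonzeroCount l) * φ (shape s (m + 1) l) s := by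
    intro m b hmb
    rw [← sum_add_distrib]
    refine sum_congr rfl fun l hl => ?_
    rw [← stateWeight_boundary s N m hmb l hl hs]
    ring
  have hzero : ∀ (N : ℕ) (f : ℕ → ℚ), ∑ l ∈ boxTuples 4 s, stateWeight s N 0 l
      * ((2 ^ 0 - 1) * f (nonzeroCount l)) * φ (shape s 0 l) s = 0 := by
    intro N f
    refine sum_eq_zero fun l _ => ?_
    ring
  have hfour : ∑ l ∈ boxTuples 0 s,
        stateWeight s N 4 l * markSum s 4 l (transfer s φ (shape s 4 l))
      = ∑ l ∈ boxTuples 0 s, stateWeight s N 4 l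
          * ((2 ^ 4 - 1) * (2 ^ (4 + nonzeroCount l) / 2)) * φ (shape s 4 l) s := by
    refine sum_congr rfl fun l hl => ?_
    rw [markSum_transfer (mem_boxTuples.1 hl) (by omega)]
    simp
    ring
  have hfour' : ∑ l ∈ boxTuples 0 s, stateWeight s (N + 1) 4 l *
            ∑ t, (if l t ≠ 0 then 2 ^ below l t * φ (shape s 4 l) (l t) else 0) = 0 := by
    refine sum_eq_zero fun l _ => ?_
    simp
  unfold stateSum
  have hanti : antidiagonal 4 = {(0, 4), (1, 3), (2, 2), (3, 1), (4, 0)} := by decide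
  rw [hanti]
  rw [sum_insert (by decide), sum_insert (by decide), sum_insert (by decide),
    sum_insert (by decide), sum_singleton, sum_insert (by decide), sum_insert (by decide),
    sum_insert (by decide), sum_insert (by decide), sum_singleton]
  simp only
  rw [sum_stateWeight_transfer s N 0 rfl hs, sum_stateWeight_transfer s N 1 rfl hs,
    sum_stateWeight_transfer s N 2 rfl hs, sum_stateWeight_transfer s N 3 rfl hs, hfour]
  simp only [markSum_shape_split]
  rw [hfour', hzero N (fun q => 2 ^ (0 + q) / 2), hzero (N + 1) (fun q => 2 ^ q)]
  have h0 := hbd 0 3 rfl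
  have h1 := hbd 1 2 rfl
  have h2 := hbd 2 1 rfl
  have h3 := hbd 3 0 rfl
  norm_num only at h0 h1 h2 h3 ⊢
  linear_combination h0 + h1 + h2 + h3

/-! ### From states to matrices -/

theorem massConst_one : massConst 1 = 1 / 15 := by rw [massConst]

/-- Before the first letter there is one state: one basis vector is marked and has value `1`. -/
theorem stateSum_zero (s : ℕ) (hs : 1 ≤ s) (φ : Multiset ℕ → ℕ → ℚ) :
    stateSum s 0 φ = φ (1 ::ₘ Multiset.replicate 3 0) 1 := by
  have hanti : antidiagonal 4 = {(0, 4), (1, 3), (2, 2), (3, 1), (4, 0)} := by decide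
  have hvan : ∀ {b : ℕ} (m : ℕ) (l : Fin b → ℕ), m * s + ∑ i, l i ≠ 1 →
      stateWeight s 0 m l * markSum s m l (φ (shape s m l)) = 0 := by
    intro b m l h
    have : excessWeight s m 0 (∑ i, l i) = 0 := by
      unfold excessWeight
      split_ifs with h1
      · have hm : m = 0 := by
          by_contra hm
          have := Nat.mul_le_mul (Nat.one_le_iff_ne_zero.2 hm) hs
          omega
        rw [show 0 + 1 - (m * s + ∑ i, l i) = 0 + 1 by omega, hm, stayCoeff]
      · rfl
    rw [stateWeight, this]
    ring
  have hm2 : ∀ (m b : ℕ), 2 ≤ m → ∑ l ∈ boxTuples b s,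
      stateWeight s 0 m l * markSum s m l (φ (shape s m l)) = 0 := by
    intro m b hm
    refine sum_eq_zero fun l _ => hvan m l ?_
    have := Nat.mul_le_mul hm hs
    omega
  rw [stateSum, hanti, sum_insert (by decide), sum_insert (by decide), sum_insert (by decide),
    sum_insert (by decide), sum_singleton, hm2 2 2 (by omega), hm2 3 1 (by omega),
    hm2 4 0 (by omega)]
  rcases Nat.eq_or_lt_of_le hs with rfl | hs
  · rw [sum_eq_zero, sum_eq_single (fun _ => 0)]
    · have hsh : shape 1 1 (fun _ : Fin 3 => 0) = 1 ::ₘ Multiset.replicate 3 0 := by decide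
      simp only [hsh]
      simp [stateWeight, markSum, massConst, gaussFour, excessWeight, stayCoeff, affLen, pairLen,
        nonzeroCount]
      norm_num
    · intro l hl hne
      exact absurd (funext fun t => by have := mem_boxTuples.1 hl t; omega) hne
    · intro h
      exact absurd (mem_boxTuples.2 fun _ => one_pos) h
    · intro l hl
      apply hvan
      have : ∀ t, l t = 0 := fun t => by have := mem_boxTuples.1 hl t; omega
      simp [this]
  · rw [sum_eq_zero (s := boxTuples 3 s)]
    swap
    · intro l _
      apply hvan
      simp only
      omega
    have himg : univ.image (fun t : Fin 4 => (Pi.single t 1 : Fin 4 → ℕ)) ⊆ boxTuples 4 s := by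
      intro l hl
      obtain ⟨t, -, rfl⟩ := mem_image.1 hl
      rw [mem_boxTuples]
      intro u
      rw [Pi.single_apply]
      split_ifs <;> omega
    rw [← sum_subset himg, sum_image]
    · have hval : ∀ t : Fin 4, stateWeight s 0 0 (Pi.single t 1 : Fin 4 → ℕ)
          * markSum s 0 (Pi.single t 1 : Fin 4 → ℕ) (φ (shape s 0 (Pi.single t 1 : Fin 4 → ℕ)))
          = (1 / 15) * 2 ^ (3 - (t : ℤ)) * φ (1 ::ₘ Multiset.replicate 3 0) 1 := by
        intro t
        have hsh : shape s 0 (Pi.single t 1 : Fin 4 → ℕ) = 1 ::ₘ Multiset.replicate 3 0 := by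
          rw [shape, Multiset.replicate_zero, zero_add]
          fin_cases t <;> decide
        have hnz : nonzeroCount (Pi.single t 1 : Fin 4 → ℕ) = 1 := by
          fin_cases t <;> decide
        have hbl : below (Pi.single t 1 : Fin 4 → ℕ) t = 0 := by
          fin_cases t <;> decide
        have hlen : affLen (Pi.single t 1 : Fin 4 → ℕ) = t := by
          fin_cases t <;> decide
        have hsum : ∑ i, (Pi.single t 1 : Fin 4 → ℕ) i = 1 := by
          fin_cases t <;> decide
        rw [stateWeight, markSum, hsh, hnz, hlen, hsum, sum_eq_single t, hbl]
        · simp [massConst_one, gaussFour, excessWeight, stayCoeff]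
        · intro u _ hu
          rw [Pi.single_eq_of_ne hu]
          simp
        · simp
      simp only [hval, Fin.sum_univ_four]
      norm_num
      ring
    · intro t _ u _ h
      by_contra hne
      have := congrFun h t
      simp only [Pi.single_eq_same, Pi.single_eq_of_ne hne] at this
      exact one_ne_zero this
    · intro l _ hl
      apply hvan
      intro hsum
      apply hl
      replace hsum : ∑ i : Fin 4, l i = 1 := by simpa using hsum
      obtain ⟨t, ht⟩ : ∃ t, l t ≠ 0 := by
        by_contra! h
        simp [h] at hsum
      rw [mem_image]
      refine ⟨t, mem_univ _, ?_⟩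
      have h1 := add_sum_erase univ l (mem_univ t)
      have h2 : ∑ u ∈ univ.erase t, l u = 0 := by omega
      rw [sum_eq_zero_iff] at h2
      funext u
      by_cases hu : u = t
      · subst hu
        rw [Pi.single_eq_same]
        omega
      · rw [Pi.single_eq_of_ne hu, h2 u (mem_erase.2 ⟨hu, mem_univ u⟩)]

/-- The multiset of the values `y`, capped at `s`. -/
def cappedValues (s : ℕ) (y : Fin 4 → ℕ) : Multiset ℕ := univ.val.map fun i => min (y i) s

theorem cappedValues_update (s : ℕ) (y : Fin 4 → ℕ) (k : Fin 4) (x : ℕ) :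
    cappedValues s (Function.update y k x)
      = min x s ::ₘ (cappedValues s y).erase (min (y k) s) := by
  unfold cappedValues
  rw [← Multiset.map_erase_of_mem (fun i => min (y i) s) _ (mem_univ_val k), ← erase_val]
  conv_lhs => rw [← insert_erase (mem_univ k)]
  rw [insert_val_of_notMem (notMem_erase k univ), Multiset.map_cons, Function.update_self]
  congr 1
  refine Multiset.map_congr rfl fun i hi => ?_
  have hi' : i ∈ univ.erase k := hi
  rw [Function.update_of_ne (ne_of_mem_erase hi')]

/-- Every word has a reduced basis, such that the capped values and the mark have the explicit
distribution `stateSum`. -/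
theorem exists_states (s : ℕ) (hs : 1 ≤ s) (N : ℕ) :
    ∃ st : (Fin N → Fin 3 → ZMod 2) → (Fin 4 → ℕ) × Fin 4,
      (∀ w, ∃ b, IsReducedBasis w (st w).1 (st w).2 b) ∧
      ∀ φ : Multiset ℕ → ℕ → ℚ,
        ∑ w, φ (cappedValues s (st w).1) (min ((st w).1 (st w).2) s) = stateSum s N φ := by
  induction N with
  | zero =>
    refine ⟨fun _ => (![1, 0, 0, 0], 0), fun w => ⟨_, isReducedBasis_zero w⟩, fun φ => ?_⟩
    rw [stateSum_zero s hs]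
    have h1 : min 1 s = 1 := by omega
    have : cappedValues s ![1, 0, 0, 0] = 1 ::ₘ Multiset.replicate 3 0 := by
      have h4 : (univ : Finset (Fin 4)).val = 0 ::ₘ 1 ::ₘ 2 ::ₘ 3 ::ₘ 0 := rfl
      rw [cappedValues, h4]
      simp [h1, Multiset.replicate_succ]
    simp [this, h1]
  | succ N ih =>
    obtain ⟨st, hst, hsum⟩ := ih
    choose e k hek using fun w => IsReducedBasis.exists_next (hst w)
    refine ⟨fun w => (Function.update (st (Fin.init w)).1 (k (Fin.init w) (w (Fin.last N)))
      ((st (Fin.init w)).1 (k (Fin.init w) (w (Fin.last N))) + 1),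
        k (Fin.init w) (w (Fin.last N))), fun w => ?_, fun φ => ?_⟩
    · have h := (hek (Fin.init w) (w (Fin.last N))).2.2
      rwa [Fin.snoc_init_self] at h
    rw [← stateSum_transfer s N hs, ← hsum]
    rw [← (Fin.snocEquiv fun _ : Fin (N + 1) => Fin 3 → ZMod 2).sum_comp, Fintype.sum_prod_type,
      sum_comm]
    refine sum_congr rfl fun w _ => ?_
    have hinit : ∀ v, Fin.init ((Fin.snocEquiv fun _ : Fin (N + 1) => Fin 3 → ZMod 2) (v, w)) = w :=
      fun v => Fin.init_snoc (α := fun _ => Fin 3 → ZMod 2) v w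
    have hlast : ∀ v,
        (Fin.snocEquiv fun _ : Fin (N + 1) => Fin 3 → ZMod 2) (v, w) (Fin.last N) = v :=
      fun v => Fin.snoc_last (α := fun _ => Fin 3 → ZMod 2) v w
    simp only [hinit, hlast, Function.update_self]
    have htr := transfer_eq_sum s φ (fun i => min ((st w).1 i) s) (st w).2
    rw [show cappedValues s (st w).1 = univ.val.map fun i => min ((st w).1 i) s from rfl, htr,
      sum_subtype (univ.filter fun c : Finset (Fin 4) => (st w).2 ∈ c)
        (p := fun c => (st w).2 ∈ c) (by simp), ← (e w).sum_comp]
    refine sum_congr rfl fun v _ => ?_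
    obtain ⟨h1, h2, -⟩ := hek w v
    rw [fold_min_erase (fun i => min ((st w).1 i) s) (e w v).2 h1
      (fun i hi => min_le_min_right s (h2 i hi)), cappedValues_update, capStep,
      show min (min ((st w).1 (k w v)) s + 1) s = min ((st w).1 (k w v) + 1) s by omega]
    rfl

/-- The values capped at `s` sum to the rank plus `s`, so the number of words whose matrix has rank
`i` is a value of `stateSum`. -/
theorem card_rank_eq (s k i : ℕ) (hs : 1 ≤ s) (hk : 1 ≤ k) :
    ((univ.filter fun w : Fin (s + k - 1) → Fin 3 → ZMod 2 => (wordMatrix s k w).rank = i).card : ℚ)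
      = stateSum s (s + k - 1) fun M _ => if M.sum = s + i then 1 else 0 := by
  obtain ⟨st, hst, hsum⟩ := exists_states s hs (s + k - 1)
  rw [← hsum, card_filter]
  push_cast
  refine sum_congr rfl fun w _ => ?_
  obtain ⟨b, hb⟩ := hst w
  have h1 := hb.rank_wordMatrix hs hk
  have h2 := hb.sum_eq
  have h3 : (cappedValues s (st w).1).sum + ∑ i, ((st w).1 i - s) = s + k := by
    change ∑ i, min ((st w).1 i) s + _ = _
    rw [← sum_add_distrib, show s + k = s + k - 1 + 1 by omega, ← h2]
    refine sum_congr rfl fun i _ => ?_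
    omega
  congr 1
  exact propext ⟨fun h => by omega, fun h => by omega⟩

/-- Triple persymmetric matrices correspond to words of length `s + k - 1` in the alphabet
`𝔽₂ ^ 3`. -/
theorem tripleGamma_eq_card (s k i : ℕ) (hs : 1 ≤ s) (hk : 1 ≤ k) :
    tripleGamma s s s k i = (univ.filter fun w : Fin (s + k - 1) → Fin 3 → ZMod 2 =>
      (wordMatrix s k w).rank = i).card := by
  unfold tripleGamma
  rw [← Set.ncard_coe_finset]
  have hinj : Function.Injective (wordMatrix s k) := by
    intro w w' h
    funext n
    obtain ⟨p, q, hpq⟩ : ∃ (p : Fin s) (q : Fin k), (p : ℕ) + q = n := by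
      by_cases hn : (n : ℕ) < s
      · exact ⟨⟨n, hn⟩, ⟨0, hk⟩, by simp⟩
      · exact ⟨⟨s - 1, by omega⟩, ⟨n - (s - 1), by omega⟩, by simp; omega⟩
    have hn : n = ⟨p + q, by omega⟩ := Fin.ext hpq.symm
    funext a
    rw [hn]
    fin_cases a
    · exact congrFun (congrFun h (Sum.inl p)) q
    · exact congrFun (congrFun h (Sum.inr (Sum.inl p))) q
    · exact congrFun (congrFun h (Sum.inr (Sum.inr p))) q
  have hword : ∀ A : Matrix (Fin s) (Fin k) (ZMod 2), IsPersymmetric A →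
      ∃ f : Fin (s + k - 1) → ZMod 2, ∀ p q, A p q = f ⟨p + q, by omega⟩ := by
    intro A hA
    refine ⟨fun n => if hn : (n : ℕ) < s then A ⟨n, hn⟩ ⟨0, hk⟩ else
      A ⟨s - 1, by omega⟩ ⟨n - (s - 1), by omega⟩, fun p q => ?_⟩
    simp only
    split_ifs with hn
    · exact hA _ _ _ _ (by simp)
    · exact hA _ _ _ _ (by simp; omega)
  have himg : {M | M ∈ triplePersymmetric s s s k ∧ M.rank = i}
      = wordMatrix s k '' {w | (wordMatrix s k w).rank = i} := by
    ext M
    constructor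
    · rintro ⟨⟨A, B, D, hA, hB, hD, rfl⟩, hr⟩
      obtain ⟨f, hf⟩ := hword A hA
      obtain ⟨g, hg⟩ := hword B hB
      obtain ⟨h, hh⟩ := hword D hD
      have : wordMatrix s k (fun n => ![f n, g n, h n])
          = Matrix.fromRows A (Matrix.fromRows B D) := by
        unfold wordMatrix
        congr 1
        · ext p q; simp [hf]
        · congr 1
          · ext p q; simp [hg]
          · ext p q; simp [hh]
      exact ⟨_, by rw [Set.mem_ofPred_eq, this]; exact hr, this⟩
    · rintro ⟨w, hw, rfl⟩
      refine ⟨⟨_, _, _, ?_, ?_, ?_, rfl⟩, hw⟩ <;>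
      · intro p r q t h
        simp only [Matrix.of_apply]
        congr 2
  rw [himg, Set.ncard_image_of_injective _ hinj]
  congr 1
  ext w
  simp

/-! ### Sums over tuples with a given sum -/

/-- The total weight of all marks on a state with `p` nonzero values, times `massConst p`. -/
def totalMass (p : ℕ) : ℚ := massConst p * (2 ^ p - 1)

/-- The weighted number of tuples in `[0, s - 1] ^ b` with sum `n`, as part of a state with `m`
values at least `s`. -/
def boxSum (m b s : ℕ) (n : ℤ) : ℚ :=
  ∑ l ∈ boxTuples b s,
    if ((∑ t, l t : ℕ) : ℤ) = n then totalMass (m + nonzeroCount l) * 2 ^ (-affLen l) else 0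

/-- The weighted number of tuples in `[1, s - 1] ^ b` with sum `n`. -/
def posSum (b s : ℕ) (n : ℤ) : ℚ :=
  ∑ l ∈ Fintype.piFinset (fun _ : Fin b => Ico 1 s),
    if ((∑ t, l t : ℕ) : ℤ) = n then 2 ^ (-affLen l) else 0

/-- Without a function of the mark, the weights of the marks form a geometric sum. -/
theorem markSum_const {b : ℕ} {s m : ℕ} {l : Fin b → ℕ} (hl : ∀ t, l t < s) (hs : s ≠ 0) (a : ℚ) :
    markSum s m l (fun _ => a) = (2 ^ (m + nonzeroCount l) - 1) * a := by
  rw [markSum_eq hl hs _ rfl, ← sum_mul, sum_two_pow_rank (stateKey_injective hl)]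
  congr 3
  rw [card_filter, Fintype.sum_sum_type, nonzeroCount, card_filter]
  congr 1
  simp [hs]

/-- The number of matrices of rank `i`, as a sum over the number `p.1` of values at least `s`. -/
theorem tripleGamma_eq_sum (s k i : ℕ) (hs : 1 ≤ s) (hk : 1 ≤ k) (hi : i ≤ k) :
    (tripleGamma s s s k i : ℚ) = ∑ p ∈ antidiagonal 4,
      gaussFour p.1 * stayCoeff p.1 (k - i)
        * 2 ^ ((p.1 : ℤ) * (p.1 - 1) * s + (3 + p.1) * (s + i - p.1 * s))
        * boxSum p.1 p.2 s (s + i - p.1 * s) := by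
  rw [tripleGamma_eq_card s k i hs hk, card_rank_eq s k i hs hk, stateSum]
  refine sum_congr rfl fun p _ => ?_
  rw [boxSum, mul_sum]
  refine sum_congr rfl fun l hl => ?_
  rw [markSum_const (mem_boxTuples.1 hl) (by omega)]
  have hsum : (shape s p.1 l).sum = p.1 * s + ∑ t, l t := by
    rw [shape, Multiset.sum_add, Multiset.sum_replicate, smul_eq_mul]
    rfl
  rw [hsum]
  by_cases h : p.1 * s + ∑ t, l t = s + i
  · have h' : ((∑ t, l t : ℕ) : ℤ) = s + i - p.1 * s := by
      have : ((p.1 * s + ∑ t, l t : ℕ) : ℤ) = ((s + i : ℕ) : ℤ) := by rw [h]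
      push_cast at this ⊢
      linarith
    rw [if_pos h, if_pos h', stateWeight, h', excessWeight, if_pos (by omega), h,
      show s + k - 1 + 1 - (s + i) = k - i by omega, sub_eq_add_neg _ (affLen l),
      zpow_add₀ two_ne_zero, totalMass]
    ring
  · rw [if_neg h, if_neg]
    · ring
    · intro h'
      apply h
      have : ((p.1 * s + ∑ t, l t : ℕ) : ℤ) = ((s + i : ℕ) : ℤ) := by
        push_cast at h' ⊢
        linarith
      exact_mod_cast this

theorem boxSum_eq_zero_of_neg {m b s : ℕ} {n : ℤ} (hn : n < 0) : boxSum m b s n = 0 := by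
  refine sum_eq_zero fun l _ => if_neg ?_
  omega

theorem boxSum_eq_zero_of_lt {m b s : ℕ} {n : ℤ} (hn : (b * (s - 1) : ℤ) < n) :
    boxSum m b s n = 0 := by
  refine sum_eq_zero fun l hl => if_neg ?_
  have h1 : ((∑ t, l t : ℕ) : ℤ) ≤ ∑ _t : Fin b, ((s : ℤ) - 1) := by
    push_cast
    refine sum_le_sum fun t _ => ?_
    have := mem_boxTuples.1 hl t
    omega
  rw [sum_const, card_univ, Fintype.card_fin, nsmul_eq_mul] at h1
  omega

/-- Moving the first entry to the end and lowering it by one preserves the length, which relates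
the tuples of sum `n` to those of sum `n - 1` up to boundary terms. -/
theorem posSum_succ (b s : ℕ) (hs : 1 ≤ s) (n : ℤ) :
    posSum (b + 1) s n = posSum (b + 1) s (n - 1)
      + 2 ^ ((b : ℤ) + 1 - n) * posSum b s (n - 1)
      - 2 ^ (n - 1 - (b + 1) * (s - 1)) * posSum b s (n - s) := by
  -- `g y` belongs to the tuples of sum `n - 1` with last entry `y`, where `y = 0` is allowed, and
  -- to their rotations, the tuples of sum `n` with first entry `y + 1`, where `y + 1 = s` is
  -- allowed
  set g : ℕ → ℚ := fun y => ∑ l ∈ Fintype.piFinset (fun _ : Fin b => Ico 1 s),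
    if ((y + ∑ t, l t : ℕ) : ℤ) = n - 1 then
      2 ^ (-affLen ((Fin.last b).insertNth (α := fun _ => ℕ) y l)) else 0 with hg
  have hlast : ∀ (y : ℕ) (l : Fin b → ℕ), affLen ((Fin.last b).insertNth (α := fun _ => ℕ) y l)
      = affLen l + ∑ u, pairLen (l u) y := by
    intro y l
    rw [affLen_insertNth]
    simp [Fin.castSucc_lt_last]
  have hfirst : ∀ (x : ℕ) (l : Fin b → ℕ),
      affLen ((0 : Fin (b + 1)).insertNth (α := fun _ => ℕ) x l)
      = affLen l + ∑ u, pairLen x (l u) := by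
    intro x l
    rw [affLen_insertNth]
    simp
  have h1 : posSum (b + 1) s (n - 1) = ∑ y ∈ Ico 1 s, g y := by
    rw [posSum, sum_piFinset_insertNth (Ico 1 s) (Fin.last b)]
    simp only [sum_insertNth]
    rfl
  have h2 : posSum (b + 1) s n = ∑ x ∈ Ico 0 (s - 1), g x := by
    rw [posSum, sum_piFinset_insertNth (Ico 1 s) 0]
    have h3 := sum_Ico_add' (fun x => ∑ l ∈ Fintype.piFinset (fun _ : Fin b => Ico 1 s),
      if ((∑ t, (0 : Fin (b + 1)).insertNth (α := fun _ => ℕ) x l t : ℕ) : ℤ) = n then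
        (2 : ℚ) ^ (-affLen ((0 : Fin (b + 1)).insertNth (α := fun _ => ℕ) x l)) else 0) 0 (s - 1) 1
    rw [zero_add, Nat.sub_add_cancel hs] at h3
    rw [← h3]
    refine sum_congr rfl fun x _ => sum_congr rfl fun l _ => ?_
    have hlen : affLen ((0 : Fin (b + 1)).insertNth (α := fun _ => ℕ) (x + 1) l)
        = affLen ((Fin.last b).insertNth (α := fun _ => ℕ) x l) := by
      rw [hfirst, hlast]
      congr 1
      refine sum_congr rfl fun u _ => ?_
      unfold pairLen
      split_ifs <;> push_cast <;> omega
    rw [hlen, sum_insertNth]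
    refine if_congr ?_ rfl rfl
    push_cast
    constructor <;> intro h <;> linarith
  have h3 : ∑ x ∈ Ico 0 (s - 1), g x + g (s - 1) = g 0 + ∑ y ∈ Ico 1 s, g y := by
    obtain ⟨r, rfl⟩ := Nat.exists_eq_add_of_le' hs
    rw [Nat.add_sub_cancel, ← sum_Ico_succ_top (Nat.zero_le r), ← sum_eq_sum_Ico_succ_bot]
    omega
  have hlow : g 0 = 2 ^ ((b : ℤ) + 1 - n) * posSum b s (n - 1) := by
    rw [hg, posSum, mul_sum]
    refine sum_congr rfl fun l hl => ?_
    rw [zero_add, hlast, mul_ite, mul_zero]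
    split_ifs with h
    · rw [← zpow_add₀ two_ne_zero]
      congr 1
      have : ∑ u, pairLen (l u) 0 = ∑ u, ((l u : ℤ) - 1) := by
        refine sum_congr rfl fun u _ => ?_
        have := (mem_Ico.1 (Fintype.mem_piFinset.1 hl u)).1
        unfold pairLen
        rw [if_pos (by omega)]
        push_cast
        ring
      rw [this, sum_sub_distrib]
      push_cast at h
      rw [h]
      simp
      ring
    · rfl
  have hhigh : g (s - 1) = 2 ^ (n - 1 - (b + 1) * (s - 1)) * posSum b s (n - s) := by
    rw [hg, posSum, mul_sum]
    refine sum_congr rfl fun l hl => ?_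
    rw [hlast, mul_ite, mul_zero]
    have hiff : ((s - 1 + ∑ t, l t : ℕ) : ℤ) = n - 1 ↔ ((∑ t, l t : ℕ) : ℤ) = n - s := by
      push_cast [hs]
      constructor <;> intro h <;> linarith
    rw [if_congr hiff rfl rfl]
    split_ifs with h
    · rw [← zpow_add₀ two_ne_zero]
      congr 1
      have : ∑ u, pairLen (l u) (s - 1) = ∑ u, (((s : ℤ) - 1) - l u) := by
        refine sum_congr rfl fun u _ => ?_
        have := (mem_Ico.1 (Fintype.mem_piFinset.1 hl u)).2
        unfold pairLen
        rw [if_neg (by omega)]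
        push_cast [hs]
        ring
      rw [this, sum_sub_distrib]
      push_cast at h
      rw [h]
      simp
      ring
    · rfl
  rw [h1, h2, ← hlow, ← hhigh]
  linarith

/-! ### Closed forms of the sums over tuples -/

theorem sum_range_eq_add_Ico_one {s : ℕ} (hs : 1 ≤ s) (f : ℕ → ℚ) :
    ∑ x ∈ range s, f x = f 0 + ∑ x ∈ Ico 1 s, f x := by
  rw [range_eq_Ico, sum_eq_sum_Ico_succ_bot (by omega)]

theorem nonzeroCount_fin_zero (l : Fin 0 → ℕ) : nonzeroCount l = 0 := by simp [nonzeroCount]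

theorem boxSum_zero_right (m s : ℕ) (n : ℤ) :
    boxSum m 0 s n = if n = 0 then totalMass m else 0 := by
  simp [boxSum, boxTuples, affLen, nonzeroCount, eq_comm]

theorem posSum_one_eq (s : ℕ) (n : ℤ) :
    posSum 1 s n = ∑ x ∈ Ico 1 s, if (x : ℤ) = n then 1 else 0 := by
  rw [posSum, sum_piFinset_insertNth _ 0]
  simp [affLen]

theorem posSum_two_eq (s : ℕ) (n : ℤ) :
    posSum 2 s n = ∑ x ∈ Ico 1 s, ∑ y ∈ Ico 1 s,
      if (x + y : ℤ) = n then 2 ^ (-pairLen x y) else 0 := by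
  rw [posSum, sum_piFinset_insertNth _ 0]
  simp only [sum_piFinset_insertNth _ 0]
  simp [affLen, Fin.sum_univ_succ]

theorem posSum_three_eq (s : ℕ) (n : ℤ) :
    posSum 3 s n = ∑ x ∈ Ico 1 s, ∑ y ∈ Ico 1 s, ∑ z ∈ Ico 1 s,
      if (x + (y + z) : ℤ) = n then 2 ^ (-(pairLen x y + pairLen x z + pairLen y z)) else 0 := by
  rw [posSum, sum_piFinset_insertNth _ 0]
  simp only [sum_piFinset_insertNth _ 0]
  simp [affLen, Fin.sum_univ_succ]

/-- The zero entries can be removed from a tuple. In `boxSum_two_right` and `boxSum_three_right` the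
factors `3 = 1 + 2` and `7 = 1 + 2 + 4` count the positions of the zeros, weighted by length. -/
theorem boxSum_one_right (m : ℕ) {s : ℕ} (hs : 1 ≤ s) (n : ℤ) :
    boxSum m 1 s n = (if n = 0 then totalMass m else 0) + totalMass (m + 1) * posSum 1 s n := by
  rw [boxSum, sum_boxTuples_insertNth 0, sum_range_eq_add_Ico_one hs, posSum_one_eq, mul_sum]
  congr 1
  · simp only [nonzeroCount_insertNth, nonzeroCount_fin_zero]
    simp [boxTuples, affLen, eq_comm]
  · refine sum_congr rfl fun x hx => ?_
    have := (mem_Ico.1 hx).1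
    simp only [nonzeroCount_insertNth, nonzeroCount_fin_zero, if_pos (show x ≠ 0 by omega)]
    simp [boxTuples, affLen]

theorem boxSum_two_right (m : ℕ) {s : ℕ} (hs : 1 ≤ s) (n : ℤ) :
    boxSum m 2 s n = (if n = 0 then totalMass m else 0)
      + 3 * 2 ^ (-n) * totalMass (m + 1) * posSum 1 s n + totalMass (m + 2) * posSum 2 s n := by
  have key : boxSum m 2 s n = ∑ x ∈ range s, ∑ y ∈ range s,
      if (x + y : ℤ) = n then totalMass (m + ((if x ≠ 0 then 1 else 0) + if y ≠ 0 then 1 else 0))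
        * 2 ^ (-pairLen x y) else 0 := by
    rw [boxSum, sum_boxTuples_insertNth 0]
    simp only [sum_boxTuples_insertNth 0, nonzeroCount_insertNth, nonzeroCount_fin_zero]
    simp [boxTuples, affLen, Fin.sum_univ_succ]
  rw [key]
  simp only [sum_range_eq_add_Ico_one hs, sum_add_distrib]
  rw [posSum_two_eq, posSum_one_eq, mul_sum, mul_sum, add_assoc, add_assoc,
    ← add_assoc (∑ y ∈ Ico 1 s, _), ← sum_add_distrib]
  congr 1
  · simp [pairLen, eq_comm]
  congr 1
  · refine sum_congr rfl fun x hx => ?_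
    have := (mem_Ico.1 hx).1
    by_cases h : (x : ℤ) = n
    · subst h
      simp [pairLen, show x ≠ 0 by omega, show 0 < x by omega]
      rw [show (1 : ℤ) - x = 1 + -x by ring, zpow_add₀ two_ne_zero]
      simp
      ring
    · simp [h]
  · refine sum_congr rfl fun x hx => ?_
    rw [mul_sum]
    refine sum_congr rfl fun y hy => ?_
    have := (mem_Ico.1 hx).1
    have := (mem_Ico.1 hy).1
    simp [show x ≠ 0 by omega, show y ≠ 0 by omega]

theorem boxSum_three_right (m : ℕ) {s : ℕ} (hs : 1 ≤ s) (n : ℤ) :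
    boxSum m 3 s n = (if n = 0 then totalMass m else 0)
      + 7 * 2 ^ (-(2 * n)) * totalMass (m + 1) * posSum 1 s n
      + 7 * 2 ^ (-n) * totalMass (m + 2) * posSum 2 s n + totalMass (m + 3) * posSum 3 s n := by
  have key : boxSum m 3 s n = ∑ x ∈ range s, ∑ y ∈ range s, ∑ z ∈ range s,
      if (x + (y + z) : ℤ) = n then totalMass (m + ((if x ≠ 0 then 1 else 0)
        + ((if y ≠ 0 then 1 else 0) + if z ≠ 0 then 1 else 0)))
        * 2 ^ (-(pairLen x y + pairLen x z + pairLen y z)) else 0 := by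
    rw [boxSum, sum_boxTuples_insertNth 0]
    simp only [sum_boxTuples_insertNth 0, nonzeroCount_insertNth, nonzeroCount_fin_zero]
    simp [boxTuples, affLen, Fin.sum_univ_succ]
  rw [key]
  simp only [sum_range_eq_add_Ico_one hs, sum_add_distrib]
  set h := fun x y z : ℕ => if (x + (y + z) : ℤ) = n then totalMass (m + ((if x ≠ 0 then 1 else 0)
        + ((if y ≠ 0 then 1 else 0) + if z ≠ 0 then 1 else 0)))
        * (2 : ℚ) ^ (-(pairLen x y + pairLen x z + pairLen y z)) else 0 with hh
  have h0 : h 0 0 0 = if n = 0 then totalMass m else 0 := by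
    simp [hh, pairLen, eq_comm]
  have h1 : ∑ x ∈ Ico 1 s, (h 0 0 x + h 0 x 0 + h x 0 0)
      = 7 * 2 ^ (-(2 * n)) * totalMass (m + 1) * posSum 1 s n := by
    rw [posSum_one_eq, mul_sum]
    refine sum_congr rfl fun x hx => ?_
    have := (mem_Ico.1 hx).1
    by_cases h : (x : ℤ) = n
    · subst h
      simp only [hh, pairLen]
      simp [show x ≠ 0 by omega, show 0 < x by omega]
      rw [show (1 : ℤ) - x + -x = 1 + -(2 * x) by ring,
        show (1 : ℤ) - x + (1 - x) = 2 + -(2 * x) by ring,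
        show -(x : ℤ) + - x = -(2 * x) by ring,
        zpow_add₀ two_ne_zero, zpow_add₀ two_ne_zero]
      simp
      ring
    · simp [hh, h]
  have h2 : ∑ x ∈ Ico 1 s, ∑ y ∈ Ico 1 s, (h 0 x y + h x 0 y + h x y 0)
      = 7 * 2 ^ (-n) * totalMass (m + 2) * posSum 2 s n := by
    rw [posSum_two_eq, mul_sum]
    refine sum_congr rfl fun x hx => ?_
    rw [mul_sum]
    refine sum_congr rfl fun y hy => ?_
    have := (mem_Ico.1 hx).1
    have := (mem_Ico.1 hy).1
    by_cases h : (x + y : ℤ) = n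
    · subst h
      simp only [hh, if_pos (show x ≠ 0 by omega), if_pos (show y ≠ 0 by omega)]
      rw [if_pos (show (((0 : ℕ) : ℤ) + (x + y) = x + y) by simp),
        if_pos (show ((x : ℤ) + ((0 : ℕ) + y) = x + y) by simp),
        if_pos (show ((x : ℤ) + (y + (0 : ℕ)) = x + y) by simp), if_pos trivial]
      have e0 : ∀ a : ℕ, pairLen 0 a = a := fun a => by simp [pairLen]
      have ex : pairLen x 0 = x - 1 := by simp [pairLen, show 0 < x by omega]
      have ey : pairLen y 0 = y - 1 := by simp [pairLen, show 0 < y by omega]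
      simp only [e0, ex, ey]
      simp
      rw [show - pairLen x y + (-(y : ℤ) + -x) = (-y + -x) + - pairLen x y by ring,
        show -(y : ℤ) + (-pairLen x y + (1 - x)) = 1 + ((-y + -x) + - pairLen x y) by ring,
        show (1 : ℤ) - y + (1 - x + -pairLen x y) = 2 + ((-y + -x) + - pairLen x y) by ring,
        zpow_add₀ two_ne_zero 1, zpow_add₀ two_ne_zero 2, zpow_add₀ two_ne_zero (-(y : ℤ) + -x)]
      simp
      ring
    · simp [hh, h]
  have h3 : ∑ x ∈ Ico 1 s, ∑ y ∈ Ico 1 s, ∑ z ∈ Ico 1 s, h x y z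
      = totalMass (m + 3) * posSum 3 s n := by
    rw [posSum_three_eq, mul_sum]
    refine sum_congr rfl fun x hx => ?_
    rw [mul_sum]
    refine sum_congr rfl fun y hy => ?_
    rw [mul_sum]
    refine sum_congr rfl fun z hz => ?_
    have := (mem_Ico.1 hx).1
    have := (mem_Ico.1 hy).1
    have := (mem_Ico.1 hz).1
    simp only [hh]
    rw [if_pos (show x ≠ 0 by omega), if_pos (show y ≠ 0 by omega), if_pos (show z ≠ 0 by omega)]
    simp
  rw [← h0, ← h1, ← h2, ← h3]
  simp only [sum_add_distrib]
  ring
theorem posSum_eq_zero_of_small {b s : ℕ} {n : ℤ} (hn : n < b) : posSum b s n = 0 := by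
  refine sum_eq_zero fun l hl => if_neg fun h => ?_
  have h1 : ∑ _t : Fin b, 1 ≤ ∑ t, l t :=
    sum_le_sum fun t _ => (mem_Ico.1 (Fintype.mem_piFinset.1 hl t)).1
  rw [sum_const, card_univ, Fintype.card_fin, smul_eq_mul, mul_one] at h1
  omega

theorem posSum_eq_zero_of_lt {b s : ℕ} {n : ℤ} (hn : (b * (s - 1) : ℤ) < n) :
    posSum b s n = 0 := by
  refine sum_eq_zero fun l hl => if_neg ?_
  have h1 : ((∑ t, l t : ℕ) : ℤ) ≤ ∑ _t : Fin b, ((s : ℤ) - 1) := by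
    push_cast
    refine sum_le_sum fun t _ => ?_
    have := (mem_Ico.1 (Fintype.mem_piFinset.1 hl t)).2
    omega
  rw [sum_const, card_univ, Fintype.card_fin, nsmul_eq_mul] at h1
  omega

theorem posSum_one {s : ℕ} {n : ℤ} (h1 : 1 ≤ n) (h2 : n < s) : posSum 1 s n = 1 := by
  obtain ⟨m, rfl⟩ := Int.eq_ofNat_of_zero_le (by omega : 0 ≤ n)
  rw [posSum_one_eq]
  simp only [Nat.cast_inj]
  rw [sum_ite_eq', if_pos (mem_Ico.2 ⟨by omega, by omega⟩)]

theorem posSum_one_of_le {s : ℕ} {n : ℤ} (h : (s : ℤ) ≤ n) : posSum 1 s n = 0 :=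
  posSum_eq_zero_of_lt (by push_cast; linarith)

theorem posSum_two_low {s : ℕ} {n : ℤ} (h1 : 1 ≤ n) (h2 : n ≤ s) :
    posSum 2 s n = 2 - 2 ^ (2 - n) := by
  have h0 : (2 : ℚ) ≠ 0 := two_ne_zero
  induction n, h1 using Int.leInduction with
  | base =>
    rw [posSum_eq_zero_of_small (by norm_num)]
    norm_num
  | succ n hn ih =>
    rw [posSum_succ 1 s (by omega), add_sub_cancel_right, ih (by omega), posSum_one hn (by omega),
      posSum_eq_zero_of_small (by omega)]
    push_cast
    simp only [zpow_add₀ h0, zpow_sub₀ h0, zpow_ofNat]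
    field_simp
    ring

theorem posSum_two_high {s : ℕ} (hs : 1 ≤ s) {n : ℤ} (h1 : s ≤ n) (h2 : n ≤ 2 * s - 1) :
    posSum 2 s n = 2 - 2 ^ (n + 2 - 2 * s) := by
  have h0 : (2 : ℚ) ≠ 0 := two_ne_zero
  induction n, h1 using Int.leInduction with
  | base =>
    rw [posSum_two_low (by omega) le_rfl]
    ring_nf
  | succ n hn ih =>
    rw [posSum_succ 1 s (by omega), add_sub_cancel_right, ih (by omega), posSum_one_of_le hn,
      posSum_one (by omega) (by omega)]
    push_cast
    simp only [zpow_add₀ h0, zpow_sub₀ h0, zpow_ofNat, mul_sub, mul_one, zpow_mul']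
    field_simp
    ring

theorem posSum_three_low {s : ℕ} {n : ℤ} (h1 : 1 ≤ n) (h2 : n ≤ s + 1) :
    posSum 3 s n = 8 / 3 - 2 ^ (4 - n) + 2 ^ (6 - 2 * n) / 3 := by
  have h0 : (2 : ℚ) ≠ 0 := two_ne_zero
  induction n, h1 using Int.leInduction with
  | base =>
    rw [posSum_eq_zero_of_small (by norm_num)]
    norm_num
  | succ n hn ih =>
    rw [posSum_succ 2 s (by omega), add_sub_cancel_right, ih (by omega),
      posSum_two_low hn (by omega), posSum_eq_zero_of_small (by push_cast; omega)]
    push_cast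
    simp only [zpow_add₀ h0, zpow_sub₀ h0, zpow_ofNat, mul_add, mul_one, zpow_mul']
    field_simp
    ring

theorem posSum_three_mid {s : ℕ} (hs : 1 ≤ s) {n : ℤ} (h1 : s ≤ n) (h2 : n ≤ 2 * s) :
    posSum 3 s n = 8 / 3 + 7 / 3 * 2 ^ (4 - 2 * s : ℤ) - 2 ^ (4 - n) - 2 ^ (n + 4 - 3 * s) := by
  have h0 : (2 : ℚ) ≠ 0 := two_ne_zero
  induction n, h1 using Int.leInduction with
  | base =>
    rw [posSum_three_low (by omega) (by omega)]
    simp only [zpow_add₀ h0, zpow_sub₀ h0, zpow_ofNat, zpow_mul']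
    field_simp
    ring
  | succ n hn ih =>
    rw [posSum_succ 2 s (by omega), add_sub_cancel_right, ih (by omega),
      posSum_two_high hs hn (by omega), posSum_two_low (by omega) (by omega)]
    push_cast
    simp only [zpow_add₀ h0, zpow_sub₀ h0, zpow_ofNat, mul_sub, mul_one, zpow_mul']
    field_simp
    ring

theorem posSum_three_high {s : ℕ} (hs : 1 ≤ s) {n : ℤ} (h1 : 2 * s ≤ n) (h2 : n ≤ 3 * s - 1) :
    posSum 3 s n = 8 / 3 - 2 ^ (4 - 3 * s + n) + 2 ^ (6 - 6 * s + 2 * n) / 3 := by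
  have h0 : (2 : ℚ) ≠ 0 := two_ne_zero
  induction n, h1 using Int.leInduction with
  | base =>
    rw [posSum_three_mid hs (by omega) le_rfl]
    simp only [zpow_add₀ h0, zpow_sub₀ h0, zpow_ofNat, zpow_mul']
    field_simp
    ring
  | succ n hn ih =>
    rw [posSum_succ 2 s (by omega), add_sub_cancel_right, ih (by omega),
      posSum_eq_zero_of_lt (by push_cast; linarith), posSum_two_high hs (by omega) (by omega)]
    push_cast
    simp only [zpow_add₀ h0, zpow_sub₀ h0, zpow_ofNat, mul_sub, mul_one, mul_add, zpow_mul']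
    field_simp
    ring

theorem stayCoeff_one (c : ℕ) : stayCoeff 1 c = 1 := by
  induction c with
  | zero => rw [stayCoeff]
  | succ c ih => simp [stayCoeff, ih]

theorem stayCoeff_two (c : ℕ) : stayCoeff 2 c = 2 ^ (c + 1) - 1 := by
  induction c with
  | zero => norm_num [stayCoeff]
  | succ c ih => rw [stayCoeff, ih, stayCoeff_one]; ring

theorem stayCoeff_three (c : ℕ) :
    stayCoeff 3 c = (2 ^ (c + 1) - 1) * (2 ^ (c + 2) - 1) / 3 := by
  induction c with
  | zero => norm_num [stayCoeff]
  | succ c ih => rw [stayCoeff, ih, stayCoeff_two]; ring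

theorem stayCoeff_four (c : ℕ) :
    stayCoeff 4 c = (2 ^ (c + 1) - 1) * (2 ^ (c + 2) - 1) * (2 ^ (c + 3) - 1) / 21 := by
  induction c with
  | zero => norm_num [stayCoeff]
  | succ c ih => rw [stayCoeff, ih, stayCoeff_three]; ring

theorem stayCoeff_zero {c : ℕ} (hc : c ≠ 0) : stayCoeff 0 c = 0 := by
  obtain ⟨d, rfl⟩ := Nat.exists_eq_succ_of_ne_zero hc
  rw [stayCoeff]

/-! ### Ranks below the number of columns, and the maximal rank -/

theorem totalMass_one : totalMass 1 = 1 / 15 := by norm_num [totalMass, massConst]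
theorem totalMass_two : totalMass 2 = 1 / 20 := by norm_num [totalMass, massConst]
theorem totalMass_three : totalMass 3 = 7 / 160 := by norm_num [totalMass, massConst]
theorem totalMass_four : totalMass 4 = 21 / 512 := by norm_num [totalMass, massConst]

/-- For ranks below the number of columns, at least one value exceeds the number of rows, so the
summand `m = 0` drops out. -/
theorem tripleGamma_eq_boxSum (s k i : ℕ) (hs : 1 ≤ s) (hi : i < k) :
    (tripleGamma s s s k i : ℚ) =
      15 * 2 ^ (4 * i : ℤ) * boxSum 1 3 s i
      + 35 * (2 ^ (k - i + 1 : ℤ) - 1) * 2 ^ (5 * i - 3 * s : ℤ) * boxSum 2 2 s (i - s)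
      + 5 * (2 ^ (k - i + 1 : ℤ) - 1) * (2 ^ (k - i + 2 : ℤ) - 1) * 2 ^ (6 * i - 6 * s : ℤ)
        * boxSum 3 1 s (i - 2 * s)
      + (2 ^ (k - i + 1 : ℤ) - 1) * (2 ^ (k - i + 2 : ℤ) - 1) * (2 ^ (k - i + 3 : ℤ) - 1) / 21
        * 2 ^ (7 * i - 9 * s : ℤ) * boxSum 4 0 s (i - 3 * s) := by
  rw [tripleGamma_eq_sum s k i hs (by omega) hi.le,
    show antidiagonal 4 = {(0, 4), (1, 3), (2, 2), (3, 1), (4, 0)} by decide,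
    sum_insert (by decide), sum_insert (by decide), sum_insert (by decide), sum_insert (by decide),
    sum_singleton]
  simp only [stayCoeff_zero (show k - i ≠ 0 by omega), stayCoeff_one, stayCoeff_two,
    stayCoeff_three, stayCoeff_four]
  have e : ∀ c : ℕ, (2 : ℚ) ^ (k - i + c) = 2 ^ (k - i + c : ℤ) := by
    intro c
    rw [← zpow_natCast]
    push_cast [hi.le]
    rfl
  rw [e, e, e]
  push_cast
  simp only [gaussFour]
  norm_num
  ring_nf

theorem tripleGamma_zero (s k : ℕ) (hs : 1 ≤ s) (hk : 1 ≤ k) : (tripleGamma s s s k 0 : ℚ) = 1 := by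
  rw [tripleGamma_eq_boxSum s k 0 hs hk, boxSum_eq_zero_of_neg (m := 2) (by push_cast; omega),
    boxSum_eq_zero_of_neg (m := 3) (by push_cast; omega),
    boxSum_eq_zero_of_neg (m := 4) (by push_cast; omega), boxSum_three_right 1 hs,
    posSum_eq_zero_of_small (b := 1) (by norm_num), posSum_eq_zero_of_small (b := 2) (by norm_num),
    posSum_eq_zero_of_small (b := 3) (by norm_num), totalMass_one]
  norm_num

theorem tripleGamma_of_lt (s k i : ℕ) (h1 : 1 ≤ i) (h2 : i + 1 ≤ s) (h3 : i + 1 ≤ k) :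
    (tripleGamma s s s k i : ℚ) =
      105 * (2 : ℚ) ^ (4 * (i : ℤ) - 6) - 21 * (2 : ℚ) ^ (3 * (i : ℤ) - 5) := by
  have h0 : (2 : ℚ) ≠ 0 := two_ne_zero
  rw [tripleGamma_eq_boxSum s k i (by omega) h3, boxSum_eq_zero_of_neg (m := 2) (by omega),
    boxSum_eq_zero_of_neg (m := 3) (by omega),
    boxSum_eq_zero_of_neg (m := 4) (by omega), boxSum_three_right 1 (by omega),
    if_neg (by omega), posSum_one (by omega) (by omega), posSum_two_low (by omega) (by omega),
    posSum_three_low (by omega) (by omega), totalMass_two, totalMass_three, totalMass_four]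
  simp only [zpow_add₀ h0, zpow_sub₀ h0, zpow_neg, zpow_ofNat, mul_sub, mul_add, zpow_mul']
  field_simp
  ring

theorem tripleGamma_of_eq (s k : ℕ) (hs : 1 ≤ s) (h : s + 1 ≤ k) :
    (tripleGamma s s s k s : ℚ) =
      7 * (2 : ℚ) ^ ((k : ℤ) + (s : ℤ) - 1) - 7 * (2 : ℚ) ^ (2 * (s : ℤ))
        + 105 * (2 : ℚ) ^ (4 * (s : ℤ) - 6) - 21 * (2 : ℚ) ^ (3 * (s : ℤ) - 5) := by
  have h0 : (2 : ℚ) ≠ 0 := two_ne_zero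
  rw [tripleGamma_eq_boxSum s k s (by omega) h,
    boxSum_eq_zero_of_neg (m := 3) (by omega),
    boxSum_eq_zero_of_neg (m := 4) (by omega), boxSum_three_right 1 (by omega),
    boxSum_two_right 2 hs, sub_self, if_pos rfl,
    if_neg (by omega), posSum_one_of_le le_rfl, posSum_two_low (by omega) (by omega),
    posSum_three_low (by omega) (by omega), posSum_eq_zero_of_small (by norm_num),
    posSum_eq_zero_of_small (by norm_num), totalMass_two, totalMass_three, totalMass_four]
  simp only [zpow_add₀ h0, zpow_sub₀ h0, zpow_neg, zpow_ofNat, mul_sub, mul_add, zpow_mul']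
  field_simp
  ring

theorem tripleGamma_add (s k j : ℕ) (h1 : 1 ≤ j) (h2 : j + 1 ≤ s) (h3 : s + j + 1 ≤ k) :
    (tripleGamma s s s k (s + j) : ℚ) =
      147 * (5 * (2 : ℚ) ^ ((j : ℤ) - 1) - 1) * (2 : ℚ) ^ ((k : ℤ) + (s : ℤ) + 3 * (j : ℤ) - 6)
        + 21 * (5 * (2 : ℚ) ^ (4 * (s : ℤ) + 4 * (j : ℤ) - 6)
          - (2 : ℚ) ^ (3 * (s : ℤ) + 3 * (j : ℤ) - 5)
          - (155 * (2 : ℚ) ^ ((j : ℤ) - 1) - 35)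
            * (2 : ℚ) ^ (2 * (s : ℤ) + 4 * (j : ℤ) - 7)) := by
  have h0 : (2 : ℚ) ≠ 0 := two_ne_zero
  rw [tripleGamma_eq_boxSum s k (s + j) (by omega) h3,
    boxSum_eq_zero_of_neg (m := 3) (by omega),
    boxSum_eq_zero_of_neg (m := 4) (by omega), boxSum_three_right 1 (by omega),
    boxSum_two_right 2 (by omega)]
  push_cast
  rw [add_sub_cancel_left, if_neg (by omega), if_neg (by omega), posSum_one_of_le (by omega),
    posSum_one (by omega) (by omega), posSum_two_high (by omega) (by omega) (by omega),
    posSum_two_low (by omega) (by omega),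
    posSum_three_mid (by omega) (by omega) (by omega), totalMass_three, totalMass_four]
  simp only [zpow_add₀ h0, zpow_sub₀ h0, zpow_neg, zpow_ofNat, mul_sub, mul_add, zpow_mul']
  field_simp
  ring

theorem tripleGamma_two_mul (s k : ℕ) (hs : 1 ≤ s) (h : 2 * s + 1 ≤ k) :
    (tripleGamma s s s k (2 * s) : ℚ) =
      7 * (2 : ℚ) ^ (2 * (k : ℤ) + 2 * (s : ℤ) - 2)
        + 21 * (35 * (2 : ℚ) ^ ((k : ℤ) + 5 * (s : ℤ) - 7)
          - 39 * (2 : ℚ) ^ ((k : ℤ) + 4 * (s : ℤ) - 6))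
        + 7 * (15 * (2 : ℚ) ^ (8 * (s : ℤ) - 6) - 465 * (2 : ℚ) ^ (7 * (s : ℤ) - 8)
          + 349 * (2 : ℚ) ^ (6 * (s : ℤ) - 7)) := by
  have h0 : (2 : ℚ) ≠ 0 := two_ne_zero
  rw [tripleGamma_eq_boxSum s k (2 * s) (by omega) h,
    boxSum_eq_zero_of_neg (m := 4) (by push_cast; omega), boxSum_three_right 1 (by omega),
    boxSum_two_right 2 (by omega), boxSum_one_right 3 (by omega)]
  push_cast
  rw [show (2 * s - s : ℤ) = s by ring, sub_self, if_neg (by omega), if_neg (by omega), if_pos rfl,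
    posSum_one_of_le (by omega), posSum_one_of_le (by omega),
    posSum_eq_zero_of_small (b := 1) (by norm_num),
    posSum_eq_zero_of_lt (b := 2) (n := 2 * s) (by push_cast; omega),
    posSum_two_low (by omega) (by omega),
    posSum_three_mid (by omega) (by omega) (by omega), totalMass_three, totalMass_four]
  simp only [zpow_add₀ h0, zpow_sub₀ h0, zpow_neg, zpow_ofNat, mul_sub, mul_add, zpow_mul']
  field_simp
  ring

theorem tripleGamma_two_mul_add (s k j : ℕ) (h2 : j + 2 ≤ s) (h3 : 2 * s + 2 + j ≤ k) :
    (tripleGamma s s s k (2 * s + 1 + j) : ℚ) =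
      105 * ((2 : ℚ) ^ (2 * (k : ℤ) + 2 * (s : ℤ) + 4 * (j : ℤ) - 2)
          + 7 * (2 : ℚ) ^ ((k : ℤ) + 5 * (s : ℤ) + 4 * (j : ℤ) - 3)
          - 31 * (2 : ℚ) ^ ((k : ℤ) + 4 * (s : ℤ) + 5 * (j : ℤ) - 3))
        + 105 * ((2 : ℚ) ^ (8 * (s : ℤ) + 4 * (j : ℤ) - 2)
          - 31 * (2 : ℚ) ^ (7 * (s : ℤ) + 5 * (j : ℤ) - 3)
          + 93 * (2 : ℚ) ^ (6 * (s : ℤ) + 6 * (j : ℤ) - 3)) := by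
  have h0 : (2 : ℚ) ≠ 0 := two_ne_zero
  rw [tripleGamma_eq_boxSum s k (2 * s + 1 + j) (by omega) (by omega),
    boxSum_eq_zero_of_neg (m := 4) (by push_cast; omega), boxSum_three_right 1 (by omega),
    boxSum_two_right 2 (by omega), boxSum_one_right 3 (by omega)]
  push_cast
  rw [show (2 * s + 1 + j - s : ℤ) = s + 1 + j by ring,
    show (2 * s + 1 + j - 2 * s : ℤ) = 1 + j by ring, if_neg (by omega), if_neg (by omega),
    if_neg (by omega),
    posSum_one_of_le (by omega), posSum_one_of_le (by omega),
    posSum_one (by omega) (by omega),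
    posSum_eq_zero_of_lt (b := 2) (n := 2 * s + 1 + j) (by push_cast; omega),
    posSum_two_high (by omega) (by omega) (by omega),
    posSum_three_high (by omega) (by omega) (by omega), totalMass_four]
  simp only [zpow_add₀ h0, zpow_sub₀ h0, zpow_neg, zpow_ofNat, mul_sub, mul_add, zpow_mul']
  field_simp
  ring

theorem tripleGamma_three_mul (s k : ℕ) (hs : 1 ≤ s) (h : 3 * s ≤ k) :
    (tripleGamma s s s k (3 * s) : ℚ) =
      (2 : ℚ) ^ (3 * (k : ℤ) + 3 * (s : ℤ) - 3) - 7 * (2 : ℚ) ^ (2 * (k : ℤ) + 6 * (s : ℤ) - 6)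
        + 7 * (2 : ℚ) ^ ((k : ℤ) + 9 * (s : ℤ) - 8) - (2 : ℚ) ^ (12 * (s : ℤ) - 9) := by
  have h0 : (2 : ℚ) ≠ 0 := two_ne_zero
  rw [tripleGamma_eq_sum s k (3 * s) hs (by omega) h,
    show antidiagonal 4 = {(0, 4), (1, 3), (2, 2), (3, 1), (4, 0)} by decide,
    sum_insert (by decide), sum_insert (by decide), sum_insert (by decide), sum_insert (by decide),
    sum_singleton]
  simp only
  rw [boxSum_eq_zero_of_lt (b := 4) (by push_cast; linarith),
    boxSum_eq_zero_of_lt (b := 3) (by push_cast; linarith),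
    boxSum_eq_zero_of_lt (b := 2) (by push_cast; linarith),
    boxSum_eq_zero_of_lt (b := 1) (by push_cast; linarith), boxSum_zero_right,
    if_pos (by push_cast; ring), stayCoeff_four, totalMass_four]
  have e : ∀ c : ℕ, (2 : ℚ) ^ (k - 3 * s + c) = 2 ^ (k - 3 * s + c : ℤ) := by
    intro c
    rw [← zpow_natCast]
    push_cast [h]
    rfl
  rw [e, e, e]
  push_cast
  simp only [gaussFour]
  norm_num
  rw [show (12 * s + 7 * (s + 3 * s - 4 * s) : ℤ) = 12 * s by ring]
  simp only [zpow_add₀ h0, zpow_sub₀ h0, zpow_ofNat, mul_sub, zpow_mul']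
  field_simp
  ring

/-! ### Rank equal to the number of columns, and the reduction formulas -/

/-- There are `8 ^ (s + k - 1)` triple persymmetric matrices altogether. -/
theorem sum_tripleGamma (s k : ℕ) (hs : 1 ≤ s) (hk : 1 ≤ k) :
    ∑ i ∈ range (k + 1), (tripleGamma s s s k i : ℚ) = 2 ^ (3 * s + 3 * k - 3 : ℤ) := by
  have h := card_eq_sum_card_fiberwise (s := (univ : Finset (Fin (s + k - 1) → Fin 3 → ZMod 2)))
    (f := fun w => (wordMatrix s k w).rank) (t := range (k + 1)) fun w _ => by
      have := (wordMatrix s k w).rank_le_card_width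
      rw [Fintype.card_fin] at this
      simpa [Nat.lt_succ_iff] using this
  have h' : ((2 : ℚ) ^ 3) ^ (s + k - 1) = ∑ i ∈ range (k + 1), (tripleGamma s s s k i : ℚ) := by
    rw [sum_congr rfl fun i _ => by rw [tripleGamma_eq_card s k i hs hk], ← Nat.cast_sum, ← h]
    norm_num [ZMod.card]
  rw [← h', ← pow_mul, ← zpow_natCast]
  congr 1
  push_cast [show 1 ≤ s + k by omega]
  ring

/-- The number of matrices of full column rank is found from the total, since the explicit
distribution is simplest for ranks below the number of columns. -/
theorem tripleGamma_self (s k : ℕ) (hs : 1 ≤ s) (hk : 1 ≤ k) :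
    (tripleGamma s s s k k : ℚ)
      = 2 ^ (3 * s + 3 * k - 3 : ℤ) - ∑ i ∈ range k, (tripleGamma s s s k i : ℚ) := by
  rw [← sum_tripleGamma s k hs hk, sum_range_succ]
  ring

theorem sum_tripleGamma_low (s k m : ℕ) (h1 : 1 ≤ m) (h2 : m ≤ s) (h3 : m ≤ k) :
    ∑ i ∈ range m, (tripleGamma s s s k i : ℚ)
      = 7 * 2 ^ (4 * m - 6 : ℤ) - 3 * 2 ^ (3 * m - 5 : ℤ) := by
  have h0 : (2 : ℚ) ≠ 0 := two_ne_zero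
  induction m, h1 using Nat.le_induction with
  | base =>
    rw [sum_range_one, tripleGamma_zero s k h2 h3]
    norm_num
  | succ m hm ih =>
    rw [sum_range_succ, ih (by omega) (by omega), tripleGamma_of_lt s k m hm h2 h3]
    push_cast
    simp only [zpow_add₀ h0, zpow_sub₀ h0, zpow_ofNat, mul_add, zpow_mul']
    field_simp
    ring

theorem sum_tripleGamma_mid (s k j : ℕ) (h1 : 1 ≤ j) (h2 : j ≤ s) (h3 : s + j ≤ k) :
    ∑ i ∈ range (s + j), (tripleGamma s s s k i : ℚ)
      = 49 * 2 ^ (k + s + 4 * j - 7 : ℤ) - 21 * 2 ^ (k + s + 3 * j - 6 : ℤ)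
        + 7 * 2 ^ (4 * s + 4 * j - 6 : ℤ) - 3 * 2 ^ (3 * s + 3 * j - 5 : ℤ)
        - 105 * 2 ^ (2 * s + 5 * j - 8 : ℤ) + 49 * 2 ^ (2 * s + 4 * j - 7 : ℤ) := by
  have h0 : (2 : ℚ) ≠ 0 := two_ne_zero
  induction j, h1 using Nat.le_induction with
  | base =>
    rw [sum_range_succ, sum_tripleGamma_low s k s h2 le_rfl (by omega), tripleGamma_of_eq s k h2 h3]
    push_cast
    simp only [zpow_add₀ h0, zpow_sub₀ h0, zpow_ofNat, zpow_mul']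
    field_simp
    ring
  | succ j hj ih =>
    rw [← add_assoc, sum_range_succ, ih (by omega) (by omega), tripleGamma_add s k j hj h2 h3]
    push_cast
    simp only [zpow_add₀ h0, zpow_sub₀ h0, zpow_ofNat, mul_sub, mul_add, zpow_mul']
    field_simp
    ring

theorem sum_tripleGamma_high (s k j : ℕ) (h2 : j + 1 ≤ s) (h3 : 2 * s + 1 + j ≤ k) :
    ∑ i ∈ range (2 * s + 1 + j), (tripleGamma s s s k i : ℚ)
      = 7 * 2 ^ (2 * k + 2 * s + 4 * j - 2 : ℤ) + 49 * 2 ^ (k + 5 * s + 4 * j - 3 : ℤ)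
        - 105 * 2 ^ (k + 4 * s + 5 * j - 3 : ℤ) + 7 * 2 ^ (8 * s + 4 * j - 2 : ℤ)
        - 105 * 2 ^ (7 * s + 5 * j - 3 : ℤ) + 155 * 2 ^ (6 * s + 6 * j - 3 : ℤ) := by
  have h0 : (2 : ℚ) ≠ 0 := two_ne_zero
  induction j with
  | zero =>
    rw [add_zero, sum_range_succ, tripleGamma_two_mul s k h2 h3, two_mul,
      sum_tripleGamma_mid s k s h2 le_rfl (by omega)]
    push_cast
    simp only [zpow_add₀ h0, zpow_sub₀ h0, zpow_ofNat, mul_sub, mul_add, zpow_mul']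
    field_simp
    ring
  | succ j ih =>
    rw [← add_assoc, sum_range_succ, ih (by omega) (by omega),
      tripleGamma_two_mul_add s k j h2 (by omega)]
    push_cast
    simp only [zpow_add₀ h0, zpow_sub₀ h0, zpow_ofNat, mul_sub, mul_add, zpow_mul']
    field_simp
    ring

theorem tripleGamma_self_high (s j : ℕ) (h : j + 1 ≤ s) :
    (tripleGamma s s s (2 * s + 1 + j) (2 * s + 1 + j) : ℚ) =
      (2 : ℚ) ^ (9 * (s : ℤ) + 3 * (j : ℤ)) - 7 * (2 : ℚ) ^ (8 * (s : ℤ) + 4 * (j : ℤ) - 2)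
        + 7 * (2 : ℚ) ^ (7 * (s : ℤ) + 5 * (j : ℤ) - 3)
        - (2 : ℚ) ^ (6 * (s : ℤ) + 6 * (j : ℤ) - 3) := by
  have h0 : (2 : ℚ) ≠ 0 := two_ne_zero
  rw [tripleGamma_self s _ (by omega) (by omega), sum_tripleGamma_high s _ j h le_rfl]
  push_cast
  simp only [zpow_add₀ h0, zpow_sub₀ h0, zpow_ofNat, mul_add, zpow_mul']
  field_simp
  ring

theorem tripleGamma_self_mid (s j : ℕ) (hs : 1 ≤ s) (h1 : 1 ≤ j) (h2 : j ≤ s + 1) :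
    (tripleGamma s s s (s + j) (s + j) : ℚ) =
      (2 : ℚ) ^ (6 * (s : ℤ) + 3 * (j : ℤ) - 3) + 7 * (2 : ℚ) ^ (2 * (s : ℤ) + 5 * (j : ℤ) - 8)
        - 7 * (2 : ℚ) ^ (2 * (s : ℤ) + 4 * (j : ℤ) - 7)
        - 7 * (2 : ℚ) ^ (4 * (s : ℤ) + 4 * (j : ℤ) - 6)
        + 3 * (2 : ℚ) ^ (3 * (s : ℤ) + 3 * (j : ℤ) - 5) := by
  have h0 : (2 : ℚ) ≠ 0 := two_ne_zero
  rcases h2.eq_or_lt with rfl | h2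
  · rw [show s + (s + 1) = 2 * s + 1 + 0 by ring, tripleGamma_self_high s 0 (by omega)]
    push_cast
    simp only [zpow_add₀ h0, zpow_sub₀ h0, zpow_ofNat, mul_add, zpow_mul']
    field_simp
    ring
  · rw [tripleGamma_self s _ (by omega) (by omega), sum_tripleGamma_mid s _ j h1 (by omega) le_rfl]
    push_cast
    simp only [zpow_add₀ h0, zpow_sub₀ h0, zpow_ofNat, mul_add, zpow_mul']
    field_simp
    ring

theorem tripleGamma_self_low (s i : ℕ) (hs : 1 ≤ s) (h1 : 1 ≤ i) (h2 : i ≤ s + 1) :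
    (tripleGamma s s s i i : ℚ) =
      (2 : ℚ) ^ (3 * (s : ℤ) + 3 * (i : ℤ) - 3) - 7 * (2 : ℚ) ^ (4 * (i : ℤ) - 6)
        + 3 * (2 : ℚ) ^ (3 * (i : ℤ) - 5) := by
  have h0 : (2 : ℚ) ≠ 0 := two_ne_zero
  rcases h2.eq_or_lt with rfl | h2
  · rw [tripleGamma_self_mid s 1 hs le_rfl (by omega)]
    push_cast
    simp only [zpow_add₀ h0, zpow_sub₀ h0, zpow_ofNat, mul_add, zpow_mul']
    field_simp
    ring
  · rw [tripleGamma_self s _ hs h1, sum_tripleGamma_low s _ i h1 (by omega) le_rfl]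
    ring

theorem sixteen_pow_three_mul (j : ℕ) : (16 : ℚ) ^ (3 * j) = 2 ^ (12 * j : ℤ) := by
  rw [show (16 : ℚ) = 2 ^ 4 by norm_num, ← pow_mul, ← zpow_natCast]
  push_cast
  ring_nf

theorem tripleGamma_reduction (s j k : ℕ) (h2 : j + 2 ≤ s) (h3 : 2 * s + 2 + j ≤ k) :
    tripleGamma s s s k (2 * s + 1 + j) =
      16 ^ (3 * j) * tripleGamma (s - j) (s - j) (s - j) (k - 3 * j) (2 * (s - j) + 1) := by
  have h0 : (2 : ℚ) ≠ 0 := two_ne_zero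
  rw [← Nat.cast_inj (R := ℚ)]
  push_cast
  rw [tripleGamma_two_mul_add s k j h2 h3,
    ← add_zero (2 * (s - j) + 1),
    tripleGamma_two_mul_add (s - j) (k - 3 * j) 0 (by omega) (by omega), sixteen_pow_three_mul]
  push_cast [show j ≤ s by omega, show 3 * j ≤ k by omega]
  simp only [zpow_add₀ h0, zpow_sub₀ h0, zpow_ofNat, mul_sub, mul_add, zpow_mul']
  field_simp

theorem tripleGamma_self_reduction (s j : ℕ) (h : j + 1 ≤ s) :
    tripleGamma s s s (2 * s + 1 + j) (2 * s + 1 + j) =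
      16 ^ (3 * j) *
        tripleGamma (s - j) (s - j) (s - j) (2 * (s - j) + 1) (2 * (s - j) + 1) := by
  have h0 : (2 : ℚ) ≠ 0 := two_ne_zero
  rw [← Nat.cast_inj (R := ℚ)]
  push_cast
  rw [tripleGamma_self_high s j h,
    ← add_zero (2 * (s - j) + 1), tripleGamma_self_high (s - j) 0 (by omega),
    sixteen_pow_three_mul]
  push_cast [show j ≤ s by omega]
  simp only [zpow_add₀ h0, zpow_sub₀ h0, zpow_ofNat, mul_sub, mul_add, zpow_mul']
  field_simp

theorem tripleGamma_three_mul_reduction (s k : ℕ) (hs : 1 ≤ s) (h : 3 * s ≤ k) :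
    tripleGamma s s s k (3 * s) =
      16 ^ (3 * (s - 1)) * tripleGamma 1 1 1 (k - 3 * (s - 1)) 3 := by
  have h0 : (2 : ℚ) ≠ 0 := two_ne_zero
  obtain ⟨r, rfl⟩ := Nat.exists_eq_add_of_le' hs
  rw [← Nat.cast_inj (R := ℚ), Nat.add_sub_cancel]
  push_cast
  have h3 := tripleGamma_three_mul 1 (k - 3 * r) le_rfl (by omega)
  rw [mul_one] at h3
  rw [tripleGamma_three_mul (r + 1) k hs h, h3,
    sixteen_pow_three_mul]
  push_cast [show 3 * r ≤ k by omega]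
  simp only [zpow_add₀ h0, zpow_sub₀ h0, zpow_ofNat, mul_sub, mul_add, zpow_mul']
  field_simp
  ring

end Distribution

theorem theorem3p2 (s : ℕ) (hs : 1 ≤ s) :
    -- the number of matrices of rank `i` with `k` columns
    (∀ k : ℕ, 1 ≤ k →
      (tripleGamma s s s k 0 : ℚ) = 1 ∧
      (∀ i : ℕ, 1 ≤ i → i + 1 ≤ s → i + 1 ≤ k →
        (tripleGamma s s s k i : ℚ) =
          105 * (2 : ℚ) ^ (4 * (i : ℤ) - 6) - 21 * (2 : ℚ) ^ (3 * (i : ℤ) - 5)) ∧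
      (s + 1 ≤ k →
        (tripleGamma s s s k s : ℚ) =
          7 * (2 : ℚ) ^ ((k : ℤ) + (s : ℤ) - 1) - 7 * (2 : ℚ) ^ (2 * (s : ℤ))
            + 105 * (2 : ℚ) ^ (4 * (s : ℤ) - 6) - 21 * (2 : ℚ) ^ (3 * (s : ℤ) - 5)) ∧
      (∀ j : ℕ, 1 ≤ j → j + 1 ≤ s → s + j + 1 ≤ k →
        (tripleGamma s s s k (s + j) : ℚ) =
          147 * (5 * (2 : ℚ) ^ ((j : ℤ) - 1) - 1) * (2 : ℚ) ^ ((k : ℤ) + (s : ℤ) + 3 * (j : ℤ) - 6)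
            + 21 * (5 * (2 : ℚ) ^ (4 * (s : ℤ) + 4 * (j : ℤ) - 6)
              - (2 : ℚ) ^ (3 * (s : ℤ) + 3 * (j : ℤ) - 5)
              - (155 * (2 : ℚ) ^ ((j : ℤ) - 1) - 35)
                * (2 : ℚ) ^ (2 * (s : ℤ) + 4 * (j : ℤ) - 7))) ∧
      (2 * s + 1 ≤ k →
        (tripleGamma s s s k (2 * s) : ℚ) =
          7 * (2 : ℚ) ^ (2 * (k : ℤ) + 2 * (s : ℤ) - 2)
            + 21 * (35 * (2 : ℚ) ^ ((k : ℤ) + 5 * (s : ℤ) - 7)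
              - 39 * (2 : ℚ) ^ ((k : ℤ) + 4 * (s : ℤ) - 6))
            + 7 * (15 * (2 : ℚ) ^ (8 * (s : ℤ) - 6) - 465 * (2 : ℚ) ^ (7 * (s : ℤ) - 8)
              + 349 * (2 : ℚ) ^ (6 * (s : ℤ) - 7))) ∧
      (∀ j : ℕ, j + 2 ≤ s → 2 * s + 2 + j ≤ k →
        (tripleGamma s s s k (2 * s + 1 + j) : ℚ) =
          105 * ((2 : ℚ) ^ (2 * (k : ℤ) + 2 * (s : ℤ) + 4 * (j : ℤ) - 2)
              + 7 * (2 : ℚ) ^ ((k : ℤ) + 5 * (s : ℤ) + 4 * (j : ℤ) - 3)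
              - 31 * (2 : ℚ) ^ ((k : ℤ) + 4 * (s : ℤ) + 5 * (j : ℤ) - 3))
            + 105 * ((2 : ℚ) ^ (8 * (s : ℤ) + 4 * (j : ℤ) - 2)
              - 31 * (2 : ℚ) ^ (7 * (s : ℤ) + 5 * (j : ℤ) - 3)
              + 93 * (2 : ℚ) ^ (6 * (s : ℤ) + 6 * (j : ℤ) - 3))) ∧
      (3 * s ≤ k →
        (tripleGamma s s s k (3 * s) : ℚ) =
          (2 : ℚ) ^ (3 * (k : ℤ) + 3 * (s : ℤ) - 3) - 7 * (2 : ℚ) ^ (2 * (k : ℤ) + 6 * (s : ℤ) - 6)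
            + 7 * (2 : ℚ) ^ ((k : ℤ) + 9 * (s : ℤ) - 8) - (2 : ℚ) ^ (12 * (s : ℤ) - 9))) ∧
    -- the case `k = i`
    (∀ i : ℕ, 1 ≤ i → i ≤ s + 1 →
      (tripleGamma s s s i i : ℚ) =
        (2 : ℚ) ^ (3 * (s : ℤ) + 3 * (i : ℤ) - 3) - 7 * (2 : ℚ) ^ (4 * (i : ℤ) - 6)
          + 3 * (2 : ℚ) ^ (3 * (i : ℤ) - 5)) ∧
    (∀ j : ℕ, 1 ≤ j → j ≤ s + 1 →
      (tripleGamma s s s (s + j) (s + j) : ℚ) =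
        (2 : ℚ) ^ (6 * (s : ℤ) + 3 * (j : ℤ) - 3) + 7 * (2 : ℚ) ^ (2 * (s : ℤ) + 5 * (j : ℤ) - 8)
          - 7 * (2 : ℚ) ^ (2 * (s : ℤ) + 4 * (j : ℤ) - 7)
          - 7 * (2 : ℚ) ^ (4 * (s : ℤ) + 4 * (j : ℤ) - 6)
          + 3 * (2 : ℚ) ^ (3 * (s : ℤ) + 3 * (j : ℤ) - 5)) ∧
    (∀ j : ℕ, j + 1 ≤ s →
      (tripleGamma s s s (2 * s + 1 + j) (2 * s + 1 + j) : ℚ) =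
        (2 : ℚ) ^ (9 * (s : ℤ) + 3 * (j : ℤ)) - 7 * (2 : ℚ) ^ (8 * (s : ℤ) + 4 * (j : ℤ) - 2)
          + 7 * (2 : ℚ) ^ (7 * (s : ℤ) + 5 * (j : ℤ) - 3)
          - (2 : ℚ) ^ (6 * (s : ℤ) + 6 * (j : ℤ) - 3)) ∧
    -- reduction formulas (all natural-number subtractions are between ordered quantities)
    (∀ j k : ℕ, j + 2 ≤ s → 2 * s + 2 + j ≤ k →
      tripleGamma s s s k (2 * s + 1 + j) =
        16 ^ (3 * j) *
          tripleGamma (s - j) (s - j) (s - j) (k - 3 * j) (2 * (s - j) + 1)) ∧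
    (∀ j : ℕ, j + 1 ≤ s →
      tripleGamma s s s (2 * s + 1 + j) (2 * s + 1 + j) =
        16 ^ (3 * j) *
          tripleGamma (s - j) (s - j) (s - j) (2 * (s - j) + 1) (2 * (s - j) + 1)) ∧
    (∀ k : ℕ, 3 * s ≤ k →
      tripleGamma s s s k (3 * s) =
        16 ^ (3 * (s - 1)) * tripleGamma 1 1 1 (k - 3 * (s - 1)) 3) := by
  refine ⟨fun k hk => ⟨tripleGamma_zero s k hs hk, tripleGamma_of_lt s k, tripleGamma_of_eq s k hs,
    tripleGamma_add s k, tripleGamma_two_mul s k hs, tripleGamma_two_mul_add s k,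
    tripleGamma_three_mul s k hs⟩, fun i => tripleGamma_self_low s i hs,
    fun j => tripleGamma_self_mid s j hs, tripleGamma_self_high s, tripleGamma_reduction s,
    tripleGamma_self_reduction s, fun k => tripleGamma_three_mul_reduction s k hs⟩
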